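/- **Setting.** Let $\mathcal H$ be a separable complex Hilbert space, $\mathcal H_2=\mathcal H\otimes\mathcal H$ its Hilbert space tensor square, and let $h$ be a (possibly unbounded) self-adjoint operator on $\mathcal H$ that is bounded below and has compact resolvent. Write $h=\sum_{e\in\mathrm{Spec}(h)}eP_e$ for its spectral resolution, $P_e$ being the orthogonal projection onto $\ker(h-e)$. Let $H_2$ be the closure of $h\otimes 1+1\otimes h$, and let $\mathcal A_2=\{\sum_{E\in\mathrm{Spec}(H_2)}f(E)P_E : f\colon\mathrm{Spec}(H_2)\to\mathbb C \text{ bounded}\}$ (strong convergence), where now $P_E$ is the orthogonal projection onto $\ker(H_2-E)$. A *collision specification* $(\mathcal C,U,\nu)$ consists of a compact metric space $\mathcal C$, an injective (strongly) continuous map $U$ from $\mathcal C$ to the unitary operators on $\mathcal H_2$, and a Borel probability measure $\nu$ on $\mathcal C$ charging every nonempty open set, such that (i) each $U(\sigma)$ commutes with $H_2$; (ii) $U(\sigma_0)=1$ for some $\sigma_0$; (iii) $\{U(\sigma)\}=\{U(\sigma)^*\}$, and the map $\sigma\mapsto\sigma'$ with $U(\sigma)^*=U(\sigma')$ is measurable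 and preserves $\nu$; (iv) with the swap $V(\phi\otimes\psi)=\psi\otimes\phi$, $\{U(\sigma)\}=\{VU(\sigma)V^*\}$, and the map $\sigma\mapsto\sigma'$ with $VU(\sigma)V^*=U(\sigma')$ is measurable and preserves $\nu$. It is *ergodic* if the commutant $\{U(\sigma):\sigma\in\mathcal C\}'$ in the bounded operators on $\mathcal H_2$ equals $\mathcal A_2$. Density matrices are the positive trace class operators of trace one. For trace class $A,B$ on $\mathcal H$ let $$A\star B=\mathrm{Tr}_2\Big[\int_{\mathcal C}U(\sigma)(A\otimes B)U(\sigma)^*\,d\nu(\sigma)\Big],$$ with $\mathrm{Tr}_2$ the partial trace over the second factor. The steady states of the quantum Kac–Boltzmann equation $\rho'=2(\rho\star\rho-\rho)$ are the density matrices $\rho$ with $\rho=\rho\star\rho$. The von Neumann entropy is $S(\rho)=-\mathrm{Tr}[\rho\log\rho]\in[0,\infty]$. **Theorem.** Let $(\mathcal C,U,\nu)$ be an ergodic collision specification. 1. If $\rho$ is a density matrix with $\rho=\rho\star\rho$ and $S(\rho)<\infty$, then $$\rho=\sum_{e\in\mathrm{Spec}(h)}\lambda_eP_e \tag{1}$$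 (convergence in operator norm) for non-negative numbers $\lambda_e$ with $\sum_{e\in\mathrm{Spec}(h)}\mathrm{Tr}[P_e]\,\lambda_e=1$, and for all $e_i,e_j,e_k,e_\ell\in\mathrm{Spec}(h)$ $$e_i+e_j=e_k+e_\ell\ \Longrightarrow\ \log\lambda_{e_i}+\log\lambda_{e_j}=\log\lambda_{e_k}+\log\lambda_{e_\ell}, \tag{2}$$ where $\log 0=-\infty$ and $-\infty+a=-\infty$ for all $a\in[-\infty,\infty)$. 2. Conversely, every density matrix $\rho$ of the form (1) with non-negative numbers $\lambda_e$ satisfying (2) is a steady state, that is, $\rho=\rho\star\rho$. -/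

import Mathlib

noncomputable section

namespace QKac

open scoped TensorProduct InnerProductSpace ENNReal NNReal BoundedContinuousFunction
open MeasureTheory UniformSpace

universe u v

/-! ### Unbounded operators -/

section Unbounded

variable {K : Type u} [NormedAddCommGroup K] [InnerProductSpace ℂ K]

/-- `R` is the resolvent `(T - z)⁻¹`: a bounded operator which maps into the domain of `T` and is
a two-sided inverse of `T - z`. -/
def IsResolventAt (T : K →ₗ.[ℂ] K) (z : ℂ) (R : K →L[ℂ] K) : Prop :=
  (∀ y : K, ∃ hy : R y ∈ T.domain, T ⟨R y, hy⟩ - z • R y = y) ∧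
    ∀ x : T.domain, R (T x - z • (x : K)) = (x : K)

/-- The (real) spectrum of an operator: the set of real `e` such that `T - e` has no bounded
inverse. All operators considered here are self-adjoint, so that this is the whole spectrum. -/
def Spec (T : K →ₗ.[ℂ] K) : Set ℝ :=
  {e : ℝ | ¬ ∃ R : K →L[ℂ] K, IsResolventAt T (e : ℂ) R}

/-- `T` has a compact resolvent. -/
def HasCompactResolvent (T : K →ₗ.[ℂ] K) : Prop :=
  ∃ (z : ℂ) (R : K →L[ℂ] K), IsResolventAt T z R ∧ IsCompactOperator R

/-- `T` is bounded below: `⟨x, T x⟩ ≥ c ‖x‖²` on the domain of `T`, for some real `c`. -/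
def IsBoundedBelow (T : K →ₗ.[ℂ] K) : Prop :=
  ∃ c : ℝ, ∀ x : T.domain, c * ‖(x : K)‖ ^ 2 ≤ (⟪(x : K), T x⟫_ℂ).re

/-- The bounded operator `B` commutes with the unbounded operator `T`, that is `B T ⊆ T B`. -/
def CommutesWith (B : K →L[ℂ] K) (T : K →ₗ.[ℂ] K) : Prop :=
  ∀ x : T.domain, ∃ hx : B (x : K) ∈ T.domain, T ⟨B (x : K), hx⟩ = B (T x)

/-- The eigenspace `ker (T - e)`. -/
def eigenspace (T : K →ₗ.[ℂ] K) (e : ℝ) : Submodule ℂ K where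
  carrier := {x | ∃ hx : x ∈ T.domain, T ⟨x, hx⟩ = (e : ℂ) • x}
  zero_mem' := ⟨T.domain.zero_mem, by
    have h0 : (⟨0, T.domain.zero_mem⟩ : T.domain) = 0 := rfl
    rw [h0, T.map_zero, smul_zero]⟩
  add_mem' := by
    rintro a b ⟨ha, ha'⟩ ⟨hb, hb'⟩
    refine ⟨T.domain.add_mem ha hb, ?_⟩
    have h0 : (⟨a + b, T.domain.add_mem ha hb⟩ : T.domain) = ⟨a, ha⟩ + ⟨b, hb⟩ := rfl
    rw [h0, T.map_add, ha', hb', smul_add]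
  smul_mem' := by
    rintro c a ⟨ha, ha'⟩
    refine ⟨T.domain.smul_mem c ha, ?_⟩
    have h0 : (⟨c • a, T.domain.smul_mem c ha⟩ : T.domain) = c • ⟨a, ha⟩ := rfl
    rw [h0, T.map_smul, ha', smul_comm]

/-- The spectral projection of `T` at `e`: the orthogonal projection onto `ker (T - e)`.
(The eigenspaces of a closed operator are closed, so that the closure changes nothing.) -/
def specProj [CompleteSpace K] (T : K →ₗ.[ℂ] K) (e : ℝ) : K →L[ℂ] K :=
  (eigenspace T e).topologicalClosure.starProjection

/-- The algebra of the bounded functions of an operator `T` with discrete spectrum: the operators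
`f(T) = ∑_E f(E) P_E`, with strong convergence, where `f` is a bounded continuous function on the
spectrum. -/
def energyAlgebra [CompleteSpace K] (T : K →ₗ.[ℂ] K) : Set (K →L[ℂ] K) :=
  {A | ∃ f : Spec T →ᵇ ℂ, ∀ x : K, HasSum (fun E : Spec T => f E • specProj T E x) (A x)}

end Unbounded

/-! ### Trace, density matrices, entropy -/

section Trace

variable {K : Type u} [NormedAddCommGroup K] [InnerProductSpace ℂ K] [CompleteSpace K]

variable (K) in
/-- The index set of a fixed Hilbert basis of `K`. -/
def basisSet : Set K := (exists_hilbertBasis ℂ K).choose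

variable (K) in
/-- A fixed Hilbert basis of `K`. -/
def hbasis : HilbertBasis (basisSet K) ℂ K := (exists_hilbertBasis ℂ K).choose_spec.choose

/-- The trace, in `[0, ∞]`, of a positive operator. It does not depend on the basis. -/
def posTrace (A : K →L[ℂ] K) : ℝ≥0∞ :=
  ∑' i : basisSet K, ENNReal.ofReal (⟪hbasis K i, A (hbasis K i)⟫_ℂ).re

/-- Density matrices: positive (hence trace class) operators of trace one. -/
def IsDensityMatrix (ρ : K →L[ℂ] K) : Prop :=
  ρ.IsPositive ∧ posTrace ρ = 1

/-- The von Neumann entropy `S(ρ) = - Tr[ρ log ρ]` of a density matrix, with values in `[0, ∞]`.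
For a density matrix the spectrum of `ρ` lies in `[0, 1]`, where `t ↦ - t log t` is nonnegative
(with `0 log 0 = 0`), and `- ρ log ρ` is the positive operator given by the functional calculus. -/
def entropy (ρ : K →L[ℂ] K) : ℝ≥0∞ :=
  posTrace (cfc Real.negMulLog ρ)

end Trace

/-! ### The two-particle space -/

section TwoParticle

variable {H : Type u} [NormedAddCommGroup H] [InnerProductSpace ℂ H]

variable (H) in
/-- The Hilbert space tensor product of `H` with itself. -/
abbrev TwoParticle : Type u := Completion (H ⊗[ℂ] H)

/-- The product vector `φ ⊗ ψ`. -/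
def tprod (φ ψ : H) : TwoParticle H := ((φ ⊗ₜ[ℂ] ψ : H ⊗[ℂ] H) : Completion (H ⊗[ℂ] H))

lemma exists_orthonormal_sum (x : H ⊗[ℂ] H) :
    ∃ (n : ℕ) (a f : Fin n → H), Orthonormal ℂ f ∧ x = ∑ j, a j ⊗ₜ[ℂ] f j := by
  obtain ⟨E', F', iE', iF', hz⟩ :=
    TensorProduct.exists_finite_submodule_of_setFinite {x} (Set.finite_singleton x)
  obtain ⟨y, hy⟩ := Set.singleton_subset_iff.mp hz
  let f := stdOrthonormalBasis ℂ F'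
  have hf : Orthonormal ℂ (fun j => ((f j : F') : H)) :=
    f.orthonormal.comp_linearIsometry F'.subtypeₗᵢ
  suffices h : ∃ a : Fin (Module.finrank ℂ F') → H, x = ∑ j, a j ⊗ₜ[ℂ] ((f j : F') : H) by
    obtain ⟨a, ha⟩ := h
    exact ⟨_, a, _, hf, ha⟩
  rw [← hy]
  clear hy hz
  induction y using TensorProduct.induction_on with
  | zero => exact ⟨0, by simp⟩
  | tmul p q =>
    refine ⟨fun j => (f.repr q j) • (p : H), ?_⟩
    have hq : (q : H) = ∑ j, f.repr q j • ((f j : F') : H) := by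
      conv_lhs => rw [← f.sum_repr q]
      push_cast
      rfl
    simp only [TensorProduct.mapIncl, TensorProduct.map_tmul, Submodule.coe_subtype]
    rw [hq, TensorProduct.tmul_sum]
    refine Finset.sum_congr rfl fun j _ => ?_
    rw [TensorProduct.smul_tmul]
  | add y z hy hz =>
    obtain ⟨a, ha⟩ := hy
    obtain ⟨b, hb⟩ := hz
    refine ⟨a + b, ?_⟩
    rw [map_add, ha, hb, ← Finset.sum_add_distrib]
    simp [TensorProduct.add_tmul]

lemma norm_sq_orthonormal_sum {n : ℕ} (a f : Fin n → H) (hf : Orthonormal ℂ f) :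
    ‖∑ j, a j ⊗ₜ[ℂ] f j‖ ^ 2 = ∑ j, ‖a j‖ ^ 2 := by
  have h := orthonormal_iff_ite.mp hf
  have h1 : ⟪∑ j, a j ⊗ₜ[ℂ] f j, ∑ j, a j ⊗ₜ[ℂ] f j⟫_ℂ = ∑ j, ⟪a j, a j⟫_ℂ := by
    simp [sum_inner, inner_sum, h]
  rw [← inner_self_eq_norm_sq (𝕜 := ℂ) (∑ j, a j ⊗ₜ[ℂ] f j)]
  refine (congrArg Complex.re h1).trans ?_
  rw [Complex.re_sum]
  exact Finset.sum_congr rfl fun j _ => inner_self_eq_norm_sq (𝕜 := ℂ) (a j)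

lemma norm_map_id_le (A : H →L[ℂ] H) (x : H ⊗[ℂ] H) :
    ‖TensorProduct.map (A : H →ₗ[ℂ] H) LinearMap.id x‖ ≤ ‖A‖ * ‖x‖ := by
  obtain ⟨n, a, f, hf, rfl⟩ := exists_orthonormal_sum x
  refine le_of_sq_le_sq ?_ (by positivity)
  simp only [map_sum, TensorProduct.map_tmul, LinearMap.id_coe, id_eq, mul_pow,
    ContinuousLinearMap.coe_coe]
  rw [norm_sq_orthonormal_sum _ f hf, norm_sq_orthonormal_sum _ f hf, Finset.mul_sum]
  refine Finset.sum_le_sum fun j _ => ?_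
  rw [← mul_pow]
  gcongr
  exact A.le_opNorm _

lemma norm_id_map_le (B : H →L[ℂ] H) (x : H ⊗[ℂ] H) :
    ‖TensorProduct.map LinearMap.id (B : H →ₗ[ℂ] H) x‖ ≤ ‖B‖ * ‖x‖ := by
  rw [← TensorProduct.norm_comm x, ← TensorProduct.norm_comm (TensorProduct.map _ _ x),
    ← TensorProduct.map_comm]
  exact norm_map_id_le B _

lemma norm_map_le (A B : H →L[ℂ] H) (x : H ⊗[ℂ] H) :
    ‖TensorProduct.map (A : H →ₗ[ℂ] H) (B : H →ₗ[ℂ] H) x‖ ≤ (‖A‖ * ‖B‖) * ‖x‖ := by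
  have h : TensorProduct.map (A : H →ₗ[ℂ] H) (B : H →ₗ[ℂ] H) x =
      TensorProduct.map (A : H →ₗ[ℂ] H) LinearMap.id
        (TensorProduct.map LinearMap.id (B : H →ₗ[ℂ] H) x) := by
    rw [← LinearMap.comp_apply, ← TensorProduct.map_comp, LinearMap.comp_id, LinearMap.id_comp]
  rw [h, mul_assoc]
  exact (norm_map_id_le A _).trans (by gcongr; exact norm_id_map_le B x)

/-- The tensor product `A ⊗ B` of two bounded operators: the continuous extension of
`φ ⊗ ψ ↦ A φ ⊗ B ψ`. -/
def opTensor (A B : H →L[ℂ] H) : TwoParticle H →L[ℂ] TwoParticle H :=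
  ((TensorProduct.map (A : H →ₗ[ℂ] H) (B : H →ₗ[ℂ] H)).mkContinuous (‖A‖ * ‖B‖)
    (norm_map_le A B)).completion

lemma opTensor_tprod (A B : H →L[ℂ] H) (φ ψ : H) :
    opTensor A B (tprod φ ψ) = tprod (A φ) (B ψ) := by
  simp [opTensor, tprod]

variable (H) in
/-- The swap operator `V (φ ⊗ ψ) = ψ ⊗ φ`. -/
def swap : TwoParticle H →L[ℂ] TwoParticle H :=
  ((TensorProduct.commIsometry ℂ H H).toLinearIsometry.toContinuousLinearMap).completion

lemma swap_tprod (φ ψ : H) : swap H (tprod φ ψ) = tprod ψ φ := by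
  simp [swap, tprod]

/-- The embedding of the algebraic tensor product `D(h) ⊗ D(h)` into the two-particle space. -/
def domainEmbed (h : H →ₗ.[ℂ] H) : h.domain ⊗[ℂ] h.domain →ₗ[ℂ] TwoParticle H :=
  (Completion.toComplL (𝕜 := ℂ) (E := H ⊗[ℂ] H)).toLinearMap ∘ₗ
    TensorProduct.mapIncl h.domain h.domain

lemma domainEmbed_injective (h : H →ₗ.[ℂ] H) : Function.Injective (domainEmbed h) := by
  have h1 : Function.Injective (TensorProduct.mapIncl h.domain h.domain) := fun _ _ hab =>
    (TensorProduct.mapInclIsometry h.domain h.domain).injective hab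
  exact (Completion.coe_injective (H ⊗[ℂ] H)).comp h1

/-- The operator `h ⊗ 1 + 1 ⊗ h` with domain the algebraic tensor product `D(h) ⊗ D(h)`. -/
def algHamiltonian₂ (h : H →ₗ.[ℂ] H) : TwoParticle H →ₗ.[ℂ] TwoParticle H where
  domain := LinearMap.range (domainEmbed h)
  toFun := ((Completion.toComplL (𝕜 := ℂ) (E := H ⊗[ℂ] H)).toLinearMap ∘ₗ
      (TensorProduct.map h.toFun h.domain.subtype + TensorProduct.map h.domain.subtype h.toFun)) ∘ₗ
    (LinearEquiv.ofInjective (domainEmbed h) (domainEmbed_injective h)).symm.toLinearMap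

lemma algHamiltonian₂_tprod (h : H →ₗ.[ℂ] H) (φ ψ : h.domain) :
    ∃ hm : tprod (φ : H) (ψ : H) ∈ (algHamiltonian₂ h).domain,
      algHamiltonian₂ h ⟨tprod (φ : H) (ψ : H), hm⟩ = tprod (h φ) (ψ : H) + tprod (φ : H) (h ψ) := by
  have hm : tprod (φ : H) (ψ : H) = domainEmbed h (φ ⊗ₜ[ℂ] ψ) := rfl
  refine ⟨⟨φ ⊗ₜ[ℂ] ψ, rfl⟩, ?_⟩
  have h1 : (LinearEquiv.ofInjective (domainEmbed h) (domainEmbed_injective h)).symm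
      ⟨tprod (φ : H) (ψ : H), ⟨φ ⊗ₜ[ℂ] ψ, rfl⟩⟩ = φ ⊗ₜ[ℂ] ψ := by
    rw [LinearEquiv.symm_apply_eq]
    rfl
  change Completion.toComplL (𝕜 := ℂ) (E := H ⊗[ℂ] H) ((TensorProduct.map h.toFun h.domain.subtype +
    TensorProduct.map h.domain.subtype h.toFun) ((LinearEquiv.ofInjective (domainEmbed h)
      (domainEmbed_injective h)).symm ⟨tprod (φ : H) (ψ : H), ⟨φ ⊗ₜ[ℂ] ψ, rfl⟩⟩)) = _
  rw [h1]
  simp only [LinearMap.add_apply, map_add, TensorProduct.map_tmul]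
  rfl

/-- The two-particle Hamiltonian `H₂ = h ⊗ 1 + 1 ⊗ h`: the closure of the operator above. -/
def hamiltonian₂ (h : H →ₗ.[ℂ] H) : TwoParticle H →ₗ.[ℂ] TwoParticle H :=
  (algHamiltonian₂ h).closure

/-- The bounded operator `H → H ⊗ H`, `φ ↦ φ ⊗ ψ`. -/
def tensorRight (ψ : H) : H →L[ℂ] TwoParticle H :=
  Completion.toComplL (𝕜 := ℂ) (E := H ⊗[ℂ] H) ∘L (TensorProduct.mkL ℂ H H).flip ψ

lemma tensorRight_apply (φ ψ : H) : tensorRight ψ φ = tprod φ ψ := rfl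

/-- The partial trace over the second factor, `Tr₂[T] = ∑ₖ Jₖ* T Jₖ` with `Jₖ φ = φ ⊗ bₖ` for a
Hilbert basis `b`; equivalently `⟨φ, Tr₂[T] ψ⟩ = ∑ₖ ⟨φ ⊗ bₖ, T (ψ ⊗ bₖ)⟩`. For a trace class
operator `T` the series converges in norm, even absolutely in trace norm, and its sum does not
depend on the basis. -/
def partialTrace₂ [CompleteSpace H] (T : TwoParticle H →L[ℂ] TwoParticle H) : H →L[ℂ] H :=
  ∑' k : basisSet H, (tensorRight (hbasis H k : H)).adjoint ∘L T ∘L tensorRight (hbasis H k : H)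

end TwoParticle

/-! ### Collisions -/

section Collisions

variable {H : Type u} [NormedAddCommGroup H] [InnerProductSpace ℂ H]

/-- A collision specification `(C, U, ν)` for the single-particle Hamiltonian `h`. Here `U` is
required to be continuous for the strong operator topology on the unitary group; every
norm-continuous `U` qualifies. -/
structure CollisionSpec (h : H →ₗ.[ℂ] H) (C : Type v) [MetricSpace C] [CompactSpace C]
    [MeasurableSpace C] [BorelSpace C] where
  /-- the collision unitaries -/
  U : C → unitary (TwoParticle H →L[ℂ] TwoParticle H)
  /-- the distribution of the collision parameter -/
  ν : Measure C
  continuous_U : ∀ x : TwoParticle H,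
    Continuous fun σ => (U σ : TwoParticle H →L[ℂ] TwoParticle H) x
  injective_U : Function.Injective U
  isProbabilityMeasure : IsProbabilityMeasure ν
  charges_open : ∀ O : Set C, IsOpen O → O.Nonempty → 0 < ν O
  commutes : ∀ σ, CommutesWith (U σ : TwoParticle H →L[ℂ] TwoParticle H) (hamiltonian₂ h)
  trivial_collision : ∃ σ₀, U σ₀ = 1
  time_reversal : ∃ τ : C → C, (∀ σ, star (U σ) = U (τ σ)) ∧ MeasurePreserving τ ν ν
  swap_symmetric : ∃ τ : C → C,
    (∀ σ, swap H ∘L (U σ : TwoParticle H →L[ℂ] TwoParticle H) ∘L (swap H).adjoint = U (τ σ)) ∧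
      MeasurePreserving τ ν ν

namespace CollisionSpec

variable {h : H →ₗ.[ℂ] H} {C : Type v} [MetricSpace C] [CompactSpace C]
    [MeasurableSpace C] [BorelSpace C]

/-- The collision unitary as a bounded operator. -/
abbrev op (S : CollisionSpec h C) (σ : C) : TwoParticle H →L[ℂ] TwoParticle H := (S.U σ).1

/-- The specification is ergodic: the commutant of the collision unitaries is the algebra of
bounded functions of the two-particle Hamiltonian. -/
def IsErgodic (S : CollisionSpec h C) : Prop :=
  {A : TwoParticle H →L[ℂ] TwoParticle H | ∀ σ, S.op σ ∘L A = A ∘L S.op σ} =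
    energyAlgebra (hamiltonian₂ h)

lemma norm_op_apply (S : CollisionSpec h C) (σ : C) (x : TwoParticle H) :
    ‖S.op σ x‖ = ‖x‖ :=
  ContinuousLinearMap.norm_map_of_mem_unitary (S.U σ).2 x

lemma norm_star_op_apply (S : CollisionSpec h C) (σ : C) (x : TwoParticle H) :
    ‖(star (S.op σ)) x‖ = ‖x‖ :=
  ContinuousLinearMap.norm_map_of_mem_unitary (Unitary.star_mem (S.U σ).2) x

lemma op_star_op_apply (S : CollisionSpec h C) (σ : C) (x : TwoParticle H) :
    S.op σ ((star (S.op σ)) x) = x := by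
  have h1 := Unitary.mul_star_self_of_mem (S.U σ).2
  exact congrArg (fun T : TwoParticle H →L[ℂ] TwoParticle H => T x) h1

lemma star_op_op_apply (S : CollisionSpec h C) (σ : C) (x : TwoParticle H) :
    (star (S.op σ)) (S.op σ x) = x := by
  have h1 := Unitary.star_mul_self_of_mem (S.U σ).2
  exact congrArg (fun T : TwoParticle H →L[ℂ] TwoParticle H => T x) h1

lemma continuous_star_op (S : CollisionSpec h C) (x : TwoParticle H) :
    Continuous fun σ => (star (S.op σ)) x := by
  rw [continuous_iff_continuousAt]
  intro σ₀
  rw [ContinuousAt, tendsto_iff_norm_sub_tendsto_zero]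
  set y := (star (S.op σ₀)) x with hy
  have h1 : ∀ σ, ‖(star (S.op σ)) x - y‖ = ‖S.op σ₀ y - S.op σ y‖ := by
    intro σ
    rw [← S.norm_op_apply σ, map_sub, S.op_star_op_apply, hy, S.op_star_op_apply]
  simp only [h1]
  have h2 : Continuous fun σ => ‖S.op σ₀ y - S.op σ y‖ :=
    (continuous_const.sub (S.continuous_U y)).norm
  simpa using h2.tendsto σ₀

lemma continuous_conj (S : CollisionSpec h C) (A : TwoParticle H →L[ℂ] TwoParticle H)
    (x : TwoParticle H) : Continuous fun σ => S.op σ (A ((star (S.op σ)) x)) := by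
  rw [continuous_iff_continuousAt]
  intro σ₀
  set y := A ((star (S.op σ₀)) x) with hy
  rw [ContinuousAt, tendsto_iff_norm_sub_tendsto_zero]
  have hc : Continuous fun σ => ‖A ((star (S.op σ)) x) - y‖ + ‖S.op σ y - S.op σ₀ y‖ :=
    ((A.continuous.comp (S.continuous_star_op x)).sub continuous_const).norm.add
      ((S.continuous_U y).sub continuous_const).norm
  have ht := hc.tendsto σ₀
  simp only [← hy, sub_self, norm_zero, add_zero] at ht
  refine squeeze_zero (fun _ => norm_nonneg _) (fun σ => ?_) ht
  calc ‖S.op σ (A ((star (S.op σ)) x)) - S.op σ₀ y‖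
      = ‖S.op σ (A ((star (S.op σ)) x) - y) + (S.op σ y - S.op σ₀ y)‖ := by
        rw [map_sub]; congr 1; abel
    _ ≤ _ := (norm_add_le _ _).trans (by rw [S.norm_op_apply])

lemma integrable_conj (S : CollisionSpec h C) (A : TwoParticle H →L[ℂ] TwoParticle H)
    (x : TwoParticle H) : Integrable (fun σ => S.op σ (A ((star (S.op σ)) x))) S.ν := by
  have := S.isProbabilityMeasure
  exact (S.continuous_conj A x).integrable_of_hasCompactSupport
    (HasCompactSupport.of_compactSpace _)

/-- The collision operator `Q A = ∫ U(σ) A U(σ)* dν(σ)`, the integral being taken in the strong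
sense: `(Q A) x = ∫ U(σ) A U(σ)* x dν(σ)`, where the integrand is continuous in `σ`. -/
def collisionOp (S : CollisionSpec h C) (A : TwoParticle H →L[ℂ] TwoParticle H) :
    TwoParticle H →L[ℂ] TwoParticle H :=
  LinearMap.mkContinuous
    { toFun := fun x => ∫ σ, S.op σ (A ((star (S.op σ)) x)) ∂S.ν
      map_add' := fun x y => by
        simp only [map_add]
        exact integral_add (S.integrable_conj A x) (S.integrable_conj A y)
      map_smul' := fun c x => by
        simp only [map_smul, RingHom.id_apply]
        exact integral_smul c _ }
    ‖A‖ (fun x => by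
      have := S.isProbabilityMeasure
      refine (norm_integral_le_of_norm_le_const (C := ‖A‖ * ‖x‖)
        (Filter.Eventually.of_forall fun σ => ?_)).trans (by simp)
      rw [S.norm_op_apply]
      refine (A.le_opNorm _).trans ?_
      rw [S.norm_star_op_apply])

lemma collisionOp_apply (S : CollisionSpec h C) (A : TwoParticle H →L[ℂ] TwoParticle H)
    (x : TwoParticle H) :
    S.collisionOp A x = ∫ σ, S.op σ (A ((star (S.op σ)) x)) ∂S.ν := rfl

/-- The quantum Wild convolution `A ⋆ B = Tr₂[Q(A ⊗ B)]` (of trace class operators). -/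
def wild [CompleteSpace H] (S : CollisionSpec h C) (A B : H →L[ℂ] H) : H →L[ℂ] H :=
  partialTrace₂ (S.collisionOp (opTensor A B))

/-- The steady states of the quantum Kac-Boltzmann equation `ρ' = 2 (ρ ⋆ ρ - ρ)`: the density
matrices `ρ` with `ρ = ρ ⋆ ρ`. -/
def IsSteadyState [CompleteSpace H] (S : CollisionSpec h C) (ρ : H →L[ℂ] H) : Prop :=
  IsDensityMatrix ρ ∧ ρ = S.wild ρ ρ

end CollisionSpec

end Collisions

/-- The coefficients `λ` on the spectrum of `h` satisfy
`e_i + e_j = e_k + e_l → log λ(e_i) + log λ(e_j) = log λ(e_k) + log λ(e_l)`.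
The logarithm takes values in `[-∞, ∞)`, with `log 0 = -∞` and `-∞ + a = -∞`. -/
def LogAdditive {H : Type u} [NormedAddCommGroup H] [InnerProductSpace ℂ H]
    {h : H →ₗ.[ℂ] H} (lam : Spec h → ℝ≥0) : Prop :=
  ∀ e₁ e₂ e₃ e₄ : Spec h, (e₁ : ℝ) + (e₂ : ℝ) = (e₃ : ℝ) + (e₄ : ℝ) →
    ENNReal.log (lam e₁) + ENNReal.log (lam e₂) = ENNReal.log (lam e₃) + ENNReal.log (lam e₄)

end QKac

end

/-!
Let `p` be the eigenvalues of a steady state `ρ`, in an orthonormal eigenbasis. The averaged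
transition probabilities `∫ |⟪x, U(σ) y⟫|² dν(σ)` between product eigenvectors form a doubly
stochastic kernel `M`. Stationarity and the swap symmetry say that both marginals of `M (p ⊗ p)` are
`p`, so the cross entropy of `M (p ⊗ p)` relative to `p ⊗ p` is `2 S(ρ)`, which is the entropy of
`p ⊗ p`. When `S(ρ) < ∞`, strictness in Gibbs' inequality then forces `p ⊗ p` to be constant along
all transitions of positive probability, that is, `ρ ⊗ ρ` commutes with every `U(σ)`. By ergodicity
`ρ ⊗ ρ` is a function of `H₂`, and evaluating it on products of eigenvectors of `h` shows that `ρ`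
is a function `λ` of `h` for which `λ(e) λ(e')` depends only on `e + e'`.

Conversely, this property of `λ` makes `ρ ⊗ ρ` constant on the eigenspaces of `H₂`, so that it
commutes with every `U(σ)`, and `ρ ⋆ ρ = Tr₂ (ρ ⊗ ρ) = ρ`.
-/

noncomputable section

namespace QKac

open scoped TensorProduct InnerProductSpace ENNReal NNReal
open MeasureTheory UniformSpace

universe u v

section HilbertBasis

variable {𝕜 K : Type*} [RCLike 𝕜] [NormedAddCommGroup K] [InnerProductSpace 𝕜 K] {ι : Type*}

lemma enorm_inner_symm (x y : K) : ‖⟪x, y⟫_𝕜‖ₑ = ‖⟪y, x⟫_𝕜‖ₑ := by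
  rw [← ofReal_norm, ← ofReal_norm, norm_inner_symm]

lemma hasSum_norm_inner_sq (b : HilbertBasis ι 𝕜 K) (x : K) :
    HasSum (fun i => ‖⟪b i, x⟫_𝕜‖ ^ 2) (‖x‖ ^ 2) := by
  have h := lp.hasSum_norm (p := 2) (by norm_num) (b.repr x)
  simpa [b.repr_apply_apply] using h

lemma tsum_enorm_inner_sq (b : HilbertBasis ι 𝕜 K) (x : K) :
    ∑' i, ‖⟪b i, x⟫_𝕜‖ₑ ^ 2 = ‖x‖ₑ ^ 2 := by
  have h := hasSum_norm_inner_sq b x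
  simp only [← ofReal_norm, ← ENNReal.ofReal_pow (norm_nonneg _)]
  rw [← ENNReal.ofReal_tsum_of_nonneg (fun i => sq_nonneg _) h.summable, h.tsum_eq]

lemma clm_ext_hilbertBasis {F : Type*} [NormedAddCommGroup F] [NormedSpace 𝕜 F]
    (b : HilbertBasis ι 𝕜 K) {A B : K →L[𝕜] F} (h : ∀ i, A (b i) = B (b i)) : A = B :=
  ContinuousLinearMap.ext_on
    (Submodule.dense_iff_topologicalClosure_eq_top.mpr b.dense_span)
    (Set.forall_mem_range.mpr h)

lemma ext_inner_hilbertBasis (b : HilbertBasis ι 𝕜 K) {x y : K}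
    (h : ∀ i, ⟪b i, x⟫_𝕜 = ⟪b i, y⟫_𝕜) : x = y := by
  refine b.repr.injective (lp.ext (funext fun i => ?_))
  simpa only [b.repr_apply_apply] using h i

lemma countable_of_orthonormal [TopologicalSpace.SeparableSpace K] {v : ι → K}
    (hv : Orthonormal 𝕜 v) : Countable ι := by
  refine Pairwise.countable_of_isOpen_disjoint (s := fun i => Metric.ball (v i) (1 / 2)) ?_
    (fun _ => Metric.isOpen_ball) (fun i => ⟨v i, by simp⟩)
  intro i j hij
  refine Metric.ball_disjoint_ball ?_
  have hsq : ‖v i - v j‖ ^ 2 = 2 := by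
    rw [norm_sub_sq (𝕜 := 𝕜), hv.1, hv.1, hv.2 hij]
    norm_num
  rw [dist_eq_norm]
  nlinarith [norm_nonneg (v i - v j)]

lemma exists_hilbertBasis_of_orthogonalFamily [CompleteSpace K] {E : ι → Submodule 𝕜 K}
    (hclosed : ∀ i, IsClosed (E i : Set K))
    (hE : OrthogonalFamily 𝕜 (fun i => E i) fun i => (E i).subtypeₗᵢ) (hbot : (⨆ i, E i)ᗮ = ⊥) :
    ∃ (s : Set K) (b : HilbertBasis s 𝕜 K), ∀ k, ∃ i, b k ∈ E i := by
  have (i : ι) : CompleteSpace (E i) := (hclosed i).completeSpace_coe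
  choose w b _ using fun i => exists_hilbertBasis 𝕜 (E i)
  let v : (Σ i, w i) → K := fun k => (b k.1 k.2 : E k.1)
  have hv : Orthonormal 𝕜 v := hE.orthonormal_sigma_orthonormal fun i => (b i).orthonormal
  have hspan : (Submodule.span 𝕜 (Set.range v))ᗮ = ⊥ := by
    rw [eq_bot_iff, ← hbot]
    intro x hx
    have hker (i : ι) : E i ≤ (innerSL 𝕜 x).ker := fun y hy => by
      have h0 : innerSL 𝕜 x ∘L (E i).subtypeL = 0 := clm_ext_hilbertBasis (b i) fun k =>
        (Submodule.mem_orthogonal' _ _).mp hx _ (Submodule.subset_span ⟨⟨i, k⟩, rfl⟩)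
      exact DFunLike.congr_fun h0 ⟨y, hy⟩
    exact (Submodule.mem_orthogonal' _ _).mpr fun y hy => iSup_le hker hy
  refine ⟨Set.range v, .mkOfOrthogonalEqBot hv.toSubtypeRange (by rwa [Subtype.range_coe]), ?_⟩
  rintro ⟨_, ⟨i, k⟩, rfl⟩
  exact ⟨i, by simp [v]⟩

end HilbertBasis

section Diagonal

variable {K : Type*} [NormedAddCommGroup K] [InnerProductSpace ℂ K] {ι : Type*}

/-- The operator `A` is diagonal in the Hilbert basis `b`, with real eigenvalues `p`. -/
def IsDiagonal (b : HilbertBasis ι ℂ K) (p : ι → ℝ) (A : K →L[ℂ] K) : Prop :=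
  ∀ i, A (b i) = (p i : ℂ) • b i

variable {b : HilbertBasis ι ℂ K} {p : ι → ℝ} {A : K →L[ℂ] K}

lemma IsDiagonal.re_inner_self (h : IsDiagonal b p A) (i : ι) : (⟪b i, A (b i)⟫_ℂ).re = p i := by
  rw [h, inner_smul_right, inner_self_eq_norm_sq_to_K, b.orthonormal.1]
  simp only [RCLike.ofReal_one, one_pow, mul_one, Complex.ofReal_re]

lemma IsDiagonal.nonneg (h : IsDiagonal b p A) (hA : A.IsPositive) (i : ι) : 0 ≤ p i :=
  (hA.re_inner_nonneg_right (b i)).trans_eq (h.re_inner_self i)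

variable [CompleteSpace K]

lemma exists_isDiagonal (hA : IsCompactOperator A) (hs : (A : K →ₗ[ℂ] K).IsSymmetric) :
    ∃ (s : Set K) (b : HilbertBasis s ℂ K) (p : s → ℝ), IsDiagonal b p A := by
  have hclosed (μ : ℂ) : IsClosed (Module.End.eigenspace (A : K →ₗ[ℂ] K) μ : Set K) := by
    have heq : (Module.End.eigenspace (A : K →ₗ[ℂ] K) μ : Set K) = {x | A x = μ • x} :=
      Set.ext fun x => Module.End.mem_eigenspace_iff
    exact heq ▸ isClosed_eq A.continuous (continuous_const_smul μ)
  obtain ⟨s, b, hb⟩ := exists_hilbertBasis_of_orthogonalFamily hclosed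
    hs.orthogonalFamily_eigenspaces
    (ContinuousLinearMap.orthogonalComplement_iSup_eigenspaces_eq_bot hA hs)
  choose μ hμ using hb
  refine ⟨s, b, fun k => (μ k).re, fun k => ?_⟩
  have hreal : ((μ k).re : ℂ) = μ k := Complex.conj_eq_iff_re.mp <|
    hs.conj_eigenvalue_eq_self <|
      Module.End.hasEigenvalue_of_hasEigenvector ⟨hμ k, b.orthonormal.ne_zero k⟩
  rw [hreal]
  exact Module.End.mem_eigenspace_iff.mp (hμ k)

namespace IsDiagonal

lemma isSelfAdjoint (h : IsDiagonal b p A) : IsSelfAdjoint A := by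
  classical
  rw [ContinuousLinearMap.isSelfAdjoint_iff']
  refine clm_ext_hilbertBasis b fun i => ext_inner_hilbertBasis b fun j => ?_
  rw [ContinuousLinearMap.adjoint_inner_right, h, h, inner_smul_left, inner_smul_right,
    orthonormal_iff_ite.mp b.orthonormal, Complex.conj_ofReal]
  split_ifs with hij
  · rw [hij]
  · simp only [mul_zero]

lemma inner_apply (h : IsDiagonal b p A) (i : ι) (x : K) : ⟪b i, A x⟫_ℂ = p i * ⟪b i, x⟫_ℂ := by
  rw [← h.isSelfAdjoint.isSymmetric.apply_clm (b i) x, h, inner_smul_left, Complex.conj_ofReal]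

lemma hasSum_re_inner (h : IsDiagonal b p A) (x : K) :
    HasSum (fun i => p i * ‖⟪b i, x⟫_ℂ‖ ^ 2) (⟪x, A x⟫_ℂ).re := by
  have hterm (i : ι) : (⟪x, b i⟫_ℂ * ⟪b i, A x⟫_ℂ).re = p i * ‖⟪b i, x⟫_ℂ‖ ^ 2 := by
    rw [h.inner_apply, ← inner_conj_symm x (b i), mul_left_comm, Complex.conj_mul',
      ← Complex.ofReal_pow, ← Complex.ofReal_mul, Complex.ofReal_re]
  simpa only [hterm] using Complex.hasSum_re (b.hasSum_inner_mul_inner x (A x))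

lemma isPositive (h : IsDiagonal b p A) (hp : ∀ i, 0 ≤ p i) : A.IsPositive := by
  refine ContinuousLinearMap.isPositive_def'.mpr ⟨h.isSelfAdjoint, fun x => ?_⟩
  rw [ContinuousLinearMap.reApplyInnerSelf_apply, inner_re_symm]
  exact (h.hasSum_re_inner x).nonneg fun i => mul_nonneg (hp i) (sq_nonneg _)

lemma ofReal_re_inner (h : IsDiagonal b p A) (hp : ∀ i, 0 ≤ p i) (x : K) :
    ENNReal.ofReal (⟪x, A x⟫_ℂ).re = ∑' i, ENNReal.ofReal (p i) * ‖⟪b i, x⟫_ℂ‖ₑ ^ 2 := by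
  have hsum := h.hasSum_re_inner x
  rw [← hsum.tsum_eq, ENNReal.ofReal_tsum_of_nonneg
    (fun i => mul_nonneg (hp i) (sq_nonneg _)) hsum.summable]
  refine tsum_congr fun i => ?_
  rw [ENNReal.ofReal_mul (hp i), ENNReal.ofReal_pow (norm_nonneg _), ofReal_norm]

lemma comp_eq_comp {U : K →L[ℂ] K} (h : IsDiagonal b p A)
    (hU : ∀ i j, ⟪b i, U (b j)⟫_ℂ ≠ 0 → p i = p j) : U ∘L A = A ∘L U := by
  refine clm_ext_hilbertBasis b fun j => ext_inner_hilbertBasis b fun i => ?_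
  simp only [ContinuousLinearMap.comp_apply, h j, map_smul, inner_smul_right, h.inner_apply]
  by_cases h0 : ⟪b i, U (b j)⟫_ℂ = 0
  · simp only [h0, mul_zero]
  · rw [hU i j h0]

end IsDiagonal

end Diagonal

section Trace

variable {K : Type*} [NormedAddCommGroup K] [InnerProductSpace ℂ K]

lemma isCompactOperator_rankOne (x y : K) :
    IsCompactOperator (InnerProductSpace.rankOne ℂ x y : K →L[ℂ] K) := by
  rw [InnerProductSpace.rankOne_def']
  exact (isCompactOperator_of_locallyCompactSpace_rng
    (ContinuousLinearMap.toSpanSingleton ℂ x)).comp_clm (innerSL ℂ y)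

variable [CompleteSpace K] {ι : Type*} {A : K →L[ℂ] K}

lemma sqrt_inner_left (A : K →L[ℂ] K) (x y : K) : ⟪CFC.sqrt A x, y⟫_ℂ = ⟪x, CFC.sqrt A y⟫_ℂ :=
  ((CFC.sqrt_nonneg A).isSelfAdjoint.isSymmetric).apply_clm x y

lemma sqrt_sqrt_apply (hA : A.IsPositive) (x : K) : CFC.sqrt A (CFC.sqrt A x) = A x :=
  DFunLike.congr_fun
    (CFC.sqrt_mul_sqrt_self A ((ContinuousLinearMap.nonneg_iff_isPositive A).mpr hA)) x

lemma ofReal_re_inner_eq_enorm_sqrt_sq (hA : A.IsPositive) (x : K) :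
    ENNReal.ofReal (⟪x, A x⟫_ℂ).re = ‖CFC.sqrt A x‖ₑ ^ 2 := by
  rw [← sqrt_sqrt_apply hA, ← sqrt_inner_left, ← ofReal_norm,
    ← ENNReal.ofReal_pow (norm_nonneg _)]
  exact congrArg _ (inner_self_eq_norm_sq (𝕜 := ℂ) _)

lemma posTrace_eq_tsum (b : HilbertBasis ι ℂ K) (hA : A.IsPositive) :
    posTrace A = ∑' i, ENNReal.ofReal (⟪b i, A (b i)⟫_ℂ).re := by
  let c := hbasis K
  calc posTrace A = ∑' k, ∑' i, ‖⟪b i, CFC.sqrt A (c k)⟫_ℂ‖ₑ ^ 2 := by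
        simp only [tsum_enorm_inner_sq, ← ofReal_re_inner_eq_enorm_sqrt_sq hA]
        rfl
    _ = ∑' i, ∑' k, ‖⟪c k, CFC.sqrt A (b i)⟫_ℂ‖ₑ ^ 2 := by
        rw [ENNReal.tsum_comm]
        refine tsum_congr fun i => tsum_congr fun k => ?_
        rw [← sqrt_inner_left, enorm_inner_symm]
    _ = ∑' i, ENNReal.ofReal (⟪b i, A (b i)⟫_ℂ).re := by
        simp only [tsum_enorm_inner_sq, ofReal_re_inner_eq_enorm_sqrt_sq hA]

lemma IsDiagonal.posTrace_eq {b : HilbertBasis ι ℂ K} {p : ι → ℝ} (h : IsDiagonal b p A)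
    (hA : A.IsPositive) : posTrace A = ∑' i, ENNReal.ofReal (p i) := by
  simp only [posTrace_eq_tsum b hA, h.re_inner_self]

lemma hasSum_rankOne_sqrt (hA : A.IsPositive) (ht : posTrace A ≠ ⊤) :
    HasSum (fun i => InnerProductSpace.rankOne ℂ (CFC.sqrt A (hbasis K i))
      (CFC.sqrt A (hbasis K i))) A := by
  have hsummable : Summable fun i => InnerProductSpace.rankOne ℂ (CFC.sqrt A (hbasis K i))
      (CFC.sqrt A (hbasis K i)) := by
    refine .of_enorm (ne_of_eq_of_ne ?_ ht)
    simp only [InnerProductSpace.enorm_rankOne, ← sq, ← ofReal_re_inner_eq_enorm_sqrt_sq hA]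
    rfl
  convert hsummable.hasSum
  ext x
  refine HasSum.unique ?_ (hsummable.hasSum.mapL (ContinuousLinearMap.apply ℂ K x))
  have hx := ((hbasis K).hasSum_repr (CFC.sqrt A x)).mapL (CFC.sqrt A)
  simpa [HilbertBasis.repr_apply_apply, sqrt_inner_left, sqrt_sqrt_apply hA] using hx

lemma isCompactOperator_of_posTrace_ne_top (hA : A.IsPositive) (ht : posTrace A ≠ ⊤) :
    IsCompactOperator A := by
  refine isCompactOperator_of_tendsto (hasSum_rankOne_sqrt hA ht) (.of_forall fun s => ?_)
  exact sum_mem (S := compactOperator (RingHom.id ℂ) K K) fun i _ => isCompactOperator_rankOne _ _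

lemma IsDensityMatrix.exists_isDiagonal (hA : IsDensityMatrix A) :
    ∃ (s : Set K) (b : HilbertBasis s ℂ K) (p : s → ℝ), IsDiagonal b p A ∧ (∀ i, 0 ≤ p i) ∧
      ∑' i, ENNReal.ofReal (p i) = 1 := by
  obtain ⟨hpos, htr⟩ := hA
  obtain ⟨s, b, p, hp⟩ := QKac.exists_isDiagonal
    (isCompactOperator_of_posTrace_ne_top hpos (by simp [htr])) hpos.isSymmetric
  exact ⟨s, b, p, hp, hp.nonneg hpos, hp.posTrace_eq hpos ▸ htr⟩

end Trace

section Entropy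

variable {K : Type*} [NormedAddCommGroup K] [InnerProductSpace ℂ K] {A : K →L[ℂ] K} {x : K} {μ : ℝ}

lemma mem_spectrum_of_apply_eq_smul (hx0 : x ≠ 0) (hx : A x = (μ : ℂ) • x) : μ ∈ spectrum ℝ A := by
  rw [spectrum.mem_iff]
  rintro ⟨V, hV⟩
  have h0 : (V : K →L[ℂ] K) x = 0 := by
    rw [hV, sub_apply, hx, Algebra.algebraMap_eq_smul_one]
    simp
  refine hx0 ?_
  calc x = (↑V⁻¹ * V : K →L[ℂ] K) x := by rw [Units.inv_mul]; rfl
    _ = 0 := by rw [mul_apply_eq_comp, h0, map_zero]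

variable [CompleteSpace K]

lemma cfc_apply_of_apply_eq_smul (hA : IsSelfAdjoint A) (hx : A x = (μ : ℂ) • x) {f : ℝ → ℝ}
    (hf : ContinuousOn f (spectrum ℝ A)) : cfc f A x = (f μ : ℂ) • x := by
  rcases eq_or_ne x 0 with rfl | hx0
  · simp only [map_zero, smul_zero]
  have hμ : μ ∈ spectrum ℝ A := mem_spectrum_of_apply_eq_smul hx0 hx
  rw [cfc_apply f A hA hf]
  suffices h : ∀ g : C(spectrum ℝ A, ℝ), cfcHom hA g x = (g ⟨μ, hμ⟩ : ℂ) • x from h _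
  intro g
  induction g using ContinuousMap.induction_on_of_compact with
  | const r =>
    have hr : ContinuousMap.const (spectrum ℝ A) r = algebraMap ℝ C(spectrum ℝ A, ℝ) r := rfl
    rw [hr, AlgHomClass.commutes, Algebra.algebraMap_eq_smul_one]
    simp
  | id => rw [cfcHom_id hA, hx]; rfl
  | star_id => rw [star_trivial, cfcHom_id hA, hx]; rfl
  | add f g hf hg => simp [map_add, hf, hg, add_smul]
  | mul f g hf hg =>
    rw [map_mul, mul_apply_eq_comp, hg, map_smul, hf, smul_smul]
    simp [mul_comm]
  | frequently f hf =>
    have hclosed : IsClosed {g : C(spectrum ℝ A, ℝ) | cfcHom hA g x = (g ⟨μ, hμ⟩ : ℂ) • x} :=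
      isClosed_eq ((ContinuousLinearMap.apply ℂ K x).continuous.comp (cfcHom_continuous hA))
        ((Complex.continuous_ofReal.comp (continuous_eval_const _)).smul continuous_const)
    exact hclosed.mem_of_frequently_of_tendsto hf Filter.tendsto_id

lemma IsDiagonal.entropy_eq {ι : Type*} {b : HilbertBasis ι ℂ K} {p : ι → ℝ}
    (h : IsDiagonal b p A) (hp0 : ∀ i, 0 ≤ p i) (hp1 : ∀ i, p i ≤ 1) :
    entropy A = ∑' i, ENNReal.ofReal (Real.negMulLog (p i)) := by
  have hdiag : IsDiagonal b (fun i => Real.negMulLog (p i)) (cfc Real.negMulLog A) := fun i =>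
    cfc_apply_of_apply_eq_smul h.isSelfAdjoint (h i) Real.continuous_negMulLog.continuousOn
  exact hdiag.posTrace_eq (hdiag.isPositive fun i => Real.negMulLog_nonneg (hp0 i) (hp1 i))

end Entropy

section CrossEntropy

/-- The surprisal `-log p` of an event of probability `p`, equal to `∞` at `p = 0` (and truncated
to `0` for `p > 1`). -/
def surprisal (p : ℝ≥0∞) : ℝ≥0∞ := (-ENNReal.log p).toENNReal

lemma surprisal_mul {p q : ℝ≥0∞} (hp : p ≤ 1) (hq : q ≤ 1) :
    surprisal (p * q) = surprisal p + surprisal q := by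
  have hp' : ENNReal.log p ≤ 0 := ENNReal.log_le_zero_iff.mpr hp
  have hq' : ENNReal.log q ≤ 0 := ENNReal.log_le_zero_iff.mpr hq
  rw [surprisal, ENNReal.log_mul_add, EReal.neg_add (.inr (hq'.trans_lt EReal.zero_lt_top).ne)
    (.inl (hp'.trans_lt EReal.zero_lt_top).ne), sub_eq_add_neg]
  exact EReal.toENNReal_add (EReal.neg_nonneg.mpr hp') (EReal.neg_nonneg.mpr hq')

lemma surprisal_zero : surprisal 0 = ⊤ := by
  simp [surprisal]

lemma surprisal_ofReal {x : ℝ} (hx : 0 < x) :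
    surprisal (ENNReal.ofReal x) = ENNReal.ofReal (-Real.log x) := by
  rw [surprisal, ENNReal.log_ofReal_of_pos hx, ← EReal.coe_neg, EReal.toENNReal_of_ne_top
    (EReal.coe_ne_top _), EReal.toReal_coe]

lemma ofReal_negMulLog {x : ℝ} (hx : 0 ≤ x) :
    ENNReal.ofReal (Real.negMulLog x) = ENNReal.ofReal x * surprisal (ENNReal.ofReal x) := by
  rcases hx.eq_or_lt with rfl | hx
  · simp
  · rw [surprisal_ofReal hx, ← ENNReal.ofReal_mul hx.le, Real.negMulLog, neg_mul_comm]

lemma log_cross_sub_eq_mul_klFun {a b : ℝ} (ha : 0 < a) (hb : 0 < b) :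
    (a * -Real.log b + b) - (a * -Real.log a + a) = b * InformationTheory.klFun (a / b) := by
  rw [InformationTheory.klFun_apply, Real.log_div ha.ne' hb.ne']
  field_simp
  ring

lemma exists_ofReal_eq_of_le_one {a : ℝ≥0∞} (h0 : a ≠ 0) (h1 : a ≤ 1) :
    ∃ x : ℝ, 0 < x ∧ x ≤ 1 ∧ ENNReal.ofReal x = a := by
  have htop : a ≠ ⊤ := ne_top_of_le_ne_top ENNReal.one_ne_top h1
  exact ⟨a.toReal, ENNReal.toReal_pos h0 htop,
    ENNReal.toReal_le_of_le_ofReal zero_le_one (by simpa), ENNReal.ofReal_toReal htop⟩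

lemma mul_surprisal_add_lt {a b : ℝ≥0∞} (ha : a ≤ 1) (hb : b ≤ 1) (hne : a ≠ b) :
    a * surprisal a + a < a * surprisal b + b := by
  rcases eq_or_ne a 0 with rfl | ha0
  · simpa [pos_iff_ne_zero] using hne.symm
  obtain ⟨x, hx, hx1, rfl⟩ := exists_ofReal_eq_of_le_one ha0 ha
  have hlogx : 0 ≤ -Real.log x := neg_nonneg.mpr (Real.log_nonpos hx.le hx1)
  rw [surprisal_ofReal hx, ← ENNReal.ofReal_mul hx.le,
    ← ENNReal.ofReal_add (mul_nonneg hx.le hlogx) hx.le]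
  rcases eq_or_ne b 0 with rfl | hb0
  · simp [surprisal_zero, ENNReal.mul_top ha0]
  obtain ⟨y, hy, hy1, rfl⟩ := exists_ofReal_eq_of_le_one hb0 hb
  have hlogy : 0 ≤ -Real.log y := neg_nonneg.mpr (Real.log_nonpos hy.le hy1)
  rw [surprisal_ofReal hy, ← ENNReal.ofReal_mul hx.le,
    ← ENNReal.ofReal_add (mul_nonneg hx.le hlogy) hy.le, ENNReal.ofReal_lt_ofReal_iff
      (add_pos_of_nonneg_of_pos (mul_nonneg hx.le hlogy) hy)]
  have hxy : x / y ≠ 1 := fun h => hne (by rw [(div_eq_one_iff_eq hy.ne').mp h])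
  have hkl : 0 < InformationTheory.klFun (x / y) :=
    (InformationTheory.klFun_nonneg (by positivity)).lt_of_ne'
      (mt (InformationTheory.klFun_eq_zero_iff (by positivity)).mp hxy)
  linarith [log_cross_sub_eq_mul_klFun hx hy, mul_pos hy hkl]

variable {ι κ : Type*}

/-- The cross entropy `-∑ q log p`. -/
def crossEntropy (q p : κ → ℝ≥0∞) : ℝ≥0∞ := ∑' k, q k * surprisal (p k)

lemma crossEntropy_prod_mul {p : ι → ℝ≥0∞} {p' : κ → ℝ≥0∞} (hp : ∀ i, p i ≤ 1)
    (hp' : ∀ j, p' j ≤ 1) (q : ι × κ → ℝ≥0∞) :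
    crossEntropy q (fun m => p m.1 * p' m.2) =
      crossEntropy (fun i => ∑' j, q (i, j)) p + crossEntropy (fun j => ∑' i, q (i, j)) p' := by
  simp only [crossEntropy, surprisal_mul (hp _) (hp' _), mul_add, ENNReal.tsum_add,
    ← ENNReal.tsum_mul_right]
  rw [ENNReal.tsum_prod', ENNReal.tsum_prod',
    ENNReal.tsum_comm (f := fun i j => _ * surprisal (p' j))]

/-- The nonnegative kernel `M` is doubly stochastic: all its rows and columns sum to one. -/
structure IsDoublyStochastic (M : κ → κ → ℝ≥0∞) : Prop where
  tsum_row : ∀ m, ∑' k, M m k = 1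
  tsum_col : ∀ k, ∑' m, M m k = 1

namespace IsDoublyStochastic

lemma eq_of_crossEntropy_le {M : κ → κ → ℝ≥0∞} (hM : IsDoublyStochastic M) {a : κ → ℝ≥0∞}
    (ha : ∀ k, a k ≤ 1) (hsum : ∑' k, a k ≠ ⊤) (hS : crossEntropy a a ≠ ⊤)
    (hle : crossEntropy (fun m => ∑' k, M m k * a k) a ≤ crossEntropy a a) {m k : κ}
    (hmk : M m k ≠ 0) : a m = a k := by
  let L : κ × κ → ℝ≥0∞ := fun q => M q.1 q.2 * (a q.2 * surprisal (a q.2) + a q.2)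
  let R : κ × κ → ℝ≥0∞ := fun q => M q.1 q.2 * (a q.2 * surprisal (a q.1) + a q.1)
  have hL : ∑' q, L q = crossEntropy a a + ∑' k, a k := by
    rw [ENNReal.tsum_prod', ENNReal.tsum_comm]
    simp only [L, ENNReal.tsum_mul_right, hM.tsum_col, one_mul, ENNReal.tsum_add, crossEntropy]
  have hR : ∑' q, R q = crossEntropy (fun m => ∑' k, M m k * a k) a + ∑' k, a k := by
    rw [ENNReal.tsum_prod']
    simp only [R, mul_add, ← mul_assoc, ENNReal.tsum_add, ENNReal.tsum_mul_right, hM.tsum_row,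
      one_mul, crossEntropy]
  have hLR (q : κ × κ) : L q ≤ R q := by
    rcases eq_or_ne (a q.2) (a q.1) with h | h
    · simp only [L, R, h, le_refl]
    · exact mul_le_mul_right (mul_surprisal_add_lt (ha _) (ha _) h).le _
  by_contra hne
  have hMtop : M m k ≠ ⊤ :=
    ne_top_of_le_ne_top ENNReal.one_ne_top ((ENNReal.le_tsum k).trans_eq (hM.tsum_row m))
  have hlt : L (m, k) < R (m, k) :=
    (ENNReal.mul_lt_mul_iff_right hmk hMtop).mpr (mul_surprisal_add_lt (ha _) (ha _) (Ne.symm hne))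
  have hfin : ∑' q, L q ≠ ⊤ := hL ▸ ENNReal.add_ne_top.mpr ⟨hS, hsum⟩
  refine (ENNReal.tsum_lt_tsum hfin hLR hlt).not_ge ?_
  rw [hL, hR]
  gcongr

lemma mul_eq_mul_of_marginals {p : ι → ℝ≥0∞} (hp : ∑' i, p i = 1) (hS : crossEntropy p p ≠ ⊤)
    {M : ι × ι → ι × ι → ℝ≥0∞} (hM : IsDoublyStochastic M)
    (h₁ : ∀ i, ∑' j, ∑' k, M (i, j) k * (p k.1 * p k.2) = p i)
    (h₂ : ∀ j, ∑' i, ∑' k, M (i, j) k * (p k.1 * p k.2) = p j)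
    {m k : ι × ι} (hmk : M m k ≠ 0) : p m.1 * p m.2 = p k.1 * p k.2 := by
  have hp1 (i : ι) : p i ≤ 1 := (ENNReal.le_tsum i).trans_eq hp
  have hprod : crossEntropy (fun m : ι × ι => p m.1 * p m.2) (fun m => p m.1 * p m.2) =
      crossEntropy p p + crossEntropy p p := by
    simp only [crossEntropy_prod_mul hp1 hp1, ENNReal.tsum_mul_left, ENNReal.tsum_mul_right, hp,
      mul_one, one_mul]
  have himage : crossEntropy (fun m => ∑' k, M m k * (p k.1 * p k.2)) (fun m => p m.1 * p m.2) =
      crossEntropy p p + crossEntropy p p := by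
    simp only [crossEntropy_prod_mul hp1 hp1, h₁, h₂]
  refine hM.eq_of_crossEntropy_le (a := fun m => p m.1 * p m.2)
    (fun m => mul_le_one' (hp1 _) (hp1 _)) ?_ ?_ (himage.trans hprod.symm).le hmk
  · simp only [ENNReal.tsum_prod', ENNReal.tsum_mul_left, hp, mul_one, ne_eq, ENNReal.one_ne_top,
      not_false_eq_true]
  · rw [hprod]
    exact ENNReal.add_ne_top.mpr ⟨hS, hS⟩

end IsDoublyStochastic

end CrossEntropy

section SpectralProjections

variable {K : Type u} [NormedAddCommGroup K] [InnerProductSpace ℂ K] {T : K →ₗ.[ℂ] K} {e e' : ℝ}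
  {x y : K}

lemma inner_eq_zero_of_mem_eigenspace (hT : T.IsFormalAdjoint T) (hne : e ≠ e')
    (hx : x ∈ eigenspace T e) (hy : y ∈ eigenspace T e') : ⟪x, y⟫_ℂ = 0 := by
  obtain ⟨hxT, hxe⟩ := hx
  obtain ⟨hyT, hye⟩ := hy
  have hsymm := hT ⟨x, hxT⟩ ⟨y, hyT⟩
  rw [hxe, hye, inner_smul_left, inner_smul_right, Complex.conj_ofReal] at hsymm
  by_contra h0
  exact hne (Complex.ofReal_injective (mul_right_cancel₀ h0 hsymm))

lemma mem_spec_of_mem_eigenspace (hx : x ∈ eigenspace T e) (hx0 : x ≠ 0) : e ∈ Spec T := by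
  rintro ⟨R, -, hR⟩
  obtain ⟨hxT, hxe⟩ := hx
  have h0 := hR ⟨x, hxT⟩
  rw [hxe, sub_self, map_zero] at h0
  exact hx0 h0.symm

lemma CommutesWith.apply_mem_eigenspace {B : K →L[ℂ] K} (hB : CommutesWith B T)
    (hx : x ∈ eigenspace T e) : B x ∈ eigenspace T e := by
  obtain ⟨hxT, hxe⟩ := hx
  obtain ⟨hBx, hval⟩ := hB ⟨x, hxT⟩
  exact ⟨hBx, by rw [hval, hxe, map_smul]⟩

/-- The bounded operator `A` is the function `f` of the operator `T` with discrete spectrum, in the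
sense that it acts as the scalar `f e` on the eigenspace `ker (T - e)`. -/
def IsFunctionOf (T : K →ₗ.[ℂ] K) (f : Spec T → ℂ) (A : K →L[ℂ] K) : Prop :=
  ∀ e : Spec T, ∀ x ∈ eigenspace T e, A x = f e • x

lemma IsFunctionOf.isDiagonal {ι : Type*} {b : HilbertBasis ι ℂ K} {ε : ι → Spec T}
    {A : K →L[ℂ] K} {lam : Spec T → ℝ} (hA : IsFunctionOf T (fun e => (lam e : ℂ)) A)
    (hb : ∀ i, b i ∈ eigenspace T (ε i)) : IsDiagonal b (fun i => lam (ε i)) A :=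
  fun i => hA (ε i) (b i) (hb i)

variable [CompleteSpace K]

lemma isFormalAdjoint_of_isSelfAdjoint (hT : IsSelfAdjoint T) : T.IsFormalAdjoint T := by
  have hadj := LinearPMap.adjoint_isFormalAdjoint (T := T) hT.dense_domain
  rwa [LinearPMap.isSelfAdjoint_def.mp hT] at hadj

lemma specProj_apply_of_mem (hx : x ∈ eigenspace T e) : specProj T e x = x :=
  Submodule.starProjection_eq_self_iff.mpr (Submodule.le_topologicalClosure _ hx)

lemma specProj_apply_of_ne (hT : T.IsFormalAdjoint T) (hne : e ≠ e') (hx : x ∈ eigenspace T e') :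
    specProj T e x = 0 := by
  rw [specProj, Submodule.starProjection_apply_eq_zero_iff, Submodule.orthogonal_closure,
    Submodule.mem_orthogonal]
  exact fun y hy => inner_eq_zero_of_mem_eigenspace hT hne hy hx

lemma isPositive_specProj (T : K →ₗ.[ℂ] K) (e : ℝ) : (specProj T e).IsPositive :=
  .of_isStarProjection isStarProjection_starProjection

lemma isFunctionOf_of_hasSum_apply (hT : T.IsFormalAdjoint T) {f : Spec T → ℂ} {A : K →L[ℂ] K}
    (hA : ∀ x, HasSum (fun e : Spec T => f e • specProj T e x) (A x)) : IsFunctionOf T f A := by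
  intro e x hx
  have hsingle : HasSum (fun e' : Spec T => f e' • specProj T e' x) (f e • specProj T e x) :=
    hasSum_single e fun e' he' => by
      rw [specProj_apply_of_ne hT (Subtype.coe_injective.ne he') hx, smul_zero]
  rw [(hA x).unique hsingle, specProj_apply_of_mem hx]

lemma isFunctionOf_of_hasSum (hT : T.IsFormalAdjoint T) {f : Spec T → ℂ} {A : K →L[ℂ] K}
    (hA : HasSum (fun e : Spec T => f e • specProj T e) A) : IsFunctionOf T f A :=
  isFunctionOf_of_hasSum_apply hT fun x => hA.mapL (ContinuousLinearMap.apply ℂ K x)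

section Eigenbasis

variable {ι : Type*} {b : HilbertBasis ι ℂ K} {ε : ι → Spec T}

lemma posTrace_specProj [DecidableEq (Spec T)] (hT : T.IsFormalAdjoint T)
    (hb : ∀ i, b i ∈ eigenspace T (ε i)) (e : Spec T) :
    posTrace (specProj T e) = ∑' i, if e = ε i then 1 else 0 := by
  have hdiag : IsDiagonal b (fun i => if e = ε i then 1 else 0) (specProj T e) := fun i => by
    dsimp only
    split_ifs with h
    · rw [specProj_apply_of_mem (h ▸ hb i), Complex.ofReal_one, one_smul]
    · rw [specProj_apply_of_ne hT (Subtype.coe_injective.ne h) (hb i),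
        Complex.ofReal_zero, zero_smul]
  rw [hdiag.posTrace_eq (isPositive_specProj T e)]
  refine tsum_congr fun i => ?_
  split_ifs <;> simp only [ENNReal.ofReal_one, ENNReal.ofReal_zero]

lemma tsum_posTrace_specProj_mul (hT : T.IsFormalAdjoint T)
    (hb : ∀ i, b i ∈ eigenspace T (ε i)) (g : Spec T → ℝ≥0∞) :
    ∑' e : Spec T, posTrace (specProj T e) * g e = ∑' i, g (ε i) := by
  classical
  simp only [posTrace_specProj hT hb, ← ENNReal.tsum_mul_right, ite_mul, one_mul, zero_mul]
  rw [ENNReal.tsum_comm]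
  simp only [tsum_ite_eq]

lemma IsFunctionOf.hasSum_smul_specProj (hT : T.IsFormalAdjoint T)
    (hb : ∀ i, b i ∈ eigenspace T (ε i)) (hε : ε.Surjective) {lam : Spec T → ℝ≥0} {A : K →L[ℂ] K}
    (hA : IsFunctionOf T (fun e => ((lam e : ℝ) : ℂ)) A) (hlam : Summable fun i => lam (ε i)) :
    HasSum (fun e : Spec T => ((lam e : ℝ) : ℂ) • specProj T e) A := by
  have hsummable_lam : Summable lam :=
    (NNReal.summable_comp_injective hlam (Function.injective_surjInv hε)).congr fun e =>
      congrArg lam (Function.surjInv_eq hε e)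
  have hsummable : Summable fun e : Spec T => ((lam e : ℝ) : ℂ) • specProj T e := by
    refine .of_norm_bounded (NNReal.summable_coe.mpr hsummable_lam) fun e => ?_
    rw [norm_smul, Complex.norm_real, NNReal.norm_eq]
    exact mul_le_of_le_one_right (lam e).2 (Submodule.starProjection_norm_le _)
  have hsum : ∑' e : Spec T, ((lam e : ℝ) : ℂ) • specProj T e = A :=
    clm_ext_hilbertBasis b fun i => by
      rw [isFunctionOf_of_hasSum hT hsummable.hasSum (ε i) _ (hb i), hA (ε i) _ (hb i)]
  exact hsum ▸ hsummable.hasSum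

lemma IsFunctionOf.spectral_resolution (hT : T.IsFormalAdjoint T)
    (hb : ∀ i, b i ∈ eigenspace T (ε i)) (hε : ε.Surjective) {lam : Spec T → ℝ≥0} {A : K →L[ℂ] K}
    (hA : IsFunctionOf T (fun e => ((lam e : ℝ) : ℂ)) A) (hdens : IsDensityMatrix A) :
    HasSum (fun e : Spec T => ((lam e : ℝ) : ℂ) • specProj T e) A ∧
      ∑' e : Spec T, posTrace (specProj T e) * (lam e : ℝ≥0∞) = 1 := by
  have hsum : ∑' i, (lam (ε i) : ℝ≥0∞) = 1 := by
    have htr := (hA.isDiagonal hb).posTrace_eq hdens.1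
    simp only [ENNReal.ofReal_coe_nnreal] at htr
    rw [← htr, hdens.2]
  refine ⟨hA.hasSum_smul_specProj hT hb hε ?_, ?_⟩
  · exact ENNReal.tsum_coe_ne_top_iff_summable.mp (hsum ▸ ENNReal.one_ne_top)
  · rw [tsum_posTrace_specProj_mul hT hb fun e => (lam e : ℝ≥0∞), hsum]

end Eigenbasis

end SpectralProjections

section Tensor

variable {H : Type u} [NormedAddCommGroup H] [InnerProductSpace ℂ H]

lemma inner_tprod (φ ψ φ' ψ' : H) : ⟪tprod φ ψ, tprod φ' ψ'⟫_ℂ = ⟪φ, φ'⟫_ℂ * ⟪ψ, ψ'⟫_ℂ := by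
  rw [tprod, tprod, Completion.inner_coe, TensorProduct.inner_tmul]

lemma norm_tprod (φ ψ : H) : ‖tprod φ ψ‖ = ‖φ‖ * ‖ψ‖ := by
  rw [tprod, Completion.norm_coe, TensorProduct.norm_tmul]

/-- The bounded operator `H → H ⊗ H`, `ψ ↦ φ ⊗ ψ`. -/
def tensorLeft (φ : H) : H →L[ℂ] TwoParticle H :=
  Completion.toComplL (𝕜 := ℂ) (E := H ⊗[ℂ] H) ∘L TensorProduct.mkL ℂ H H φ

lemma tprod_smul_left (c : ℂ) (φ ψ : H) : tprod (c • φ) ψ = c • tprod φ ψ :=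
  (tensorRight ψ).map_smul c φ

lemma tprod_smul_right (c : ℂ) (φ ψ : H) : tprod φ (c • ψ) = c • tprod φ ψ :=
  (tensorLeft φ).map_smul c ψ

lemma tprod_ne_zero {φ ψ : H} (hφ : φ ≠ 0) (hψ : ψ ≠ 0) : tprod φ ψ ≠ 0 := by
  rw [← norm_ne_zero_iff, norm_tprod]
  exact mul_ne_zero (norm_ne_zero_iff.mpr hφ) (norm_ne_zero_iff.mpr hψ)

lemma clm_ext_tprod {F : Type*} [NormedAddCommGroup F] [NormedSpace ℂ F]
    {A B : TwoParticle H →L[ℂ] F} (h : ∀ φ ψ, A (tprod φ ψ) = B (tprod φ ψ)) : A = B := by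
  have hcoe (z : H ⊗[ℂ] H) : A (z : Completion (H ⊗[ℂ] H)) = B z := by
    induction z using TensorProduct.induction_on with
    | zero => rw [Completion.coe_zero, map_zero, map_zero]
    | tmul φ ψ => exact h φ ψ
    | add y z hy hz => rw [Completion.coe_add, map_add, map_add, hy, hz]
  exact ContinuousLinearMap.coeFn_injective (Completion.ext A.continuous B.continuous hcoe)

lemma ext_inner_tprod {x y : TwoParticle H} (h : ∀ φ ψ, ⟪x, tprod φ ψ⟫_ℂ = ⟪y, tprod φ ψ⟫_ℂ) :
    x = y :=
  ext_inner_right ℂ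
    (DFunLike.congr_fun (clm_ext_tprod (A := innerSL ℂ x) (B := innerSL ℂ y) h))

lemma adjoint_swap : (swap H).adjoint = swap H :=
  clm_ext_tprod fun φ ψ => ext_inner_tprod fun φ' ψ' => by
    rw [ContinuousLinearMap.adjoint_inner_left, swap_tprod, swap_tprod, inner_tprod, inner_tprod,
      mul_comm]

lemma swap_inner (x y : TwoParticle H) : ⟪swap H x, y⟫_ℂ = ⟪x, swap H y⟫_ℂ := by
  rw [← ContinuousLinearMap.adjoint_inner_right, adjoint_swap]

section TensorBasis

variable {ι κ : Type*} (b : HilbertBasis ι ℂ H) (c : HilbertBasis κ ℂ H)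

lemma orthonormal_tprod : Orthonormal ℂ fun k : ι × κ => tprod (b k.1) (c k.2) :=
  (b.orthonormal.tmul c.orthonormal).comp_linearIsometry Completion.toComplₗᵢ

lemma orthogonal_span_tprod_eq_bot :
    (Submodule.span ℂ (Set.range fun k : ι × κ => tprod (b k.1) (c k.2)))ᗮ = ⊥ := by
  refine (Submodule.eq_bot_iff _).mpr fun x hx => ext_inner_tprod fun φ ψ => ?_
  have hbasis (i : ι) (j : κ) : ⟪x, tprod (b i) (c j)⟫_ℂ = 0 :=
    (Submodule.mem_orthogonal' _ _).mp hx _ (Submodule.subset_span ⟨(i, j), rfl⟩)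
  have hleft (i : ι) : innerSL ℂ x ∘L tensorLeft (b i) = 0 := clm_ext_hilbertBasis c (hbasis i)
  have hright : innerSL ℂ x ∘L tensorRight ψ = 0 :=
    clm_ext_hilbertBasis b fun i => DFunLike.congr_fun (hleft i) ψ
  exact (DFunLike.congr_fun hright φ).trans (inner_zero_left _).symm

/-- The Hilbert basis `b i ⊗ c j` of the two-particle space. -/
def tensorBasis : HilbertBasis (ι × κ) ℂ (TwoParticle H) :=
  .mkOfOrthogonalEqBot (orthonormal_tprod b c) (orthogonal_span_tprod_eq_bot b c)

lemma tensorBasis_apply (k : ι × κ) : tensorBasis b c k = tprod (b k.1) (c k.2) := by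
  rw [tensorBasis, HilbertBasis.coe_mkOfOrthogonalEqBot]

variable {b c}

lemma IsDiagonal.opTensor {p : ι → ℝ} {q : κ → ℝ} {A B : H →L[ℂ] H} (hA : IsDiagonal b p A)
    (hB : IsDiagonal c q B) :
    IsDiagonal (tensorBasis b c) (fun k => p k.1 * q k.2) (opTensor A B) := fun k => by
  rw [tensorBasis_apply, opTensor_tprod, hA, hB, tprod_smul_left, tprod_smul_right, smul_smul,
    Complex.ofReal_mul]

end TensorBasis

end Tensor

section TwoParticleHamiltonian

lemma isFormalAdjoint_closure_left {E F : Type*} [NormedAddCommGroup E] [InnerProductSpace ℂ E]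
    [NormedAddCommGroup F] [InnerProductSpace ℂ F] {T : E →ₗ.[ℂ] F} {S : F →ₗ.[ℂ] E}
    (h : T.IsFormalAdjoint S) : T.closure.IsFormalAdjoint S := by
  by_cases hT : T.IsClosable
  · intro x y
    have hclosed : IsClosed {p : E × F | ⟪p.2, (y : F)⟫_ℂ = ⟪p.1, S y⟫_ℂ} :=
      isClosed_eq (by fun_prop) (by fun_prop)
    have hgraph : (T.graph : Set (E × F)) ⊆ {p | ⟪p.2, (y : F)⟫_ℂ = ⟪p.1, S y⟫_ℂ} := by
      intro p hp
      obtain ⟨z, hz₁, hz₂⟩ := T.mem_graph_iff.mp hp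
      rw [Set.mem_ofPred_eq, ← hz₁, ← hz₂]
      exact h z y
    have hx := T.closure.mem_graph x
    rw [← hT.graph_closure_eq_closure_graph] at hx
    exact closure_minimal hgraph hclosed hx
  · rwa [LinearPMap.closure_def' hT]

variable {H : Type u} [NormedAddCommGroup H] [InnerProductSpace ℂ H] {h : H →ₗ.[ℂ] H}

/-- The algebraic operator `h ⊗ 1 + 1 ⊗ h` on `D(h) ⊗ D(h)`, with values in the uncompleted tensor
product. -/
def energySum (h : H →ₗ.[ℂ] H) : h.domain ⊗[ℂ] h.domain →ₗ[ℂ] H ⊗[ℂ] H :=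
  TensorProduct.map h.toFun h.domain.subtype + TensorProduct.map h.domain.subtype h.toFun

lemma algHamiltonian₂_domainEmbed (u : h.domain ⊗[ℂ] h.domain) :
    algHamiltonian₂ h ⟨domainEmbed h u, ⟨u, rfl⟩⟩ = (energySum h u : Completion (H ⊗[ℂ] H)) := by
  have hu : (LinearEquiv.ofInjective (domainEmbed h) (domainEmbed_injective h)).symm
      ⟨domainEmbed h u, ⟨u, rfl⟩⟩ = u := by
    rw [LinearEquiv.symm_apply_eq]
    rfl
  exact congrArg (fun z => (energySum h z : Completion (H ⊗[ℂ] H))) hu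

lemma inner_energySum_left (hh : h.IsFormalAdjoint h) (u v : h.domain ⊗[ℂ] h.domain) :
    ⟪energySum h u, TensorProduct.mapIncl h.domain h.domain v⟫_ℂ =
      ⟪TensorProduct.mapIncl h.domain h.domain u, energySum h v⟫_ℂ := by
  have hsymm (a c : h.domain) : ⟪h.toFun a, (c : H)⟫_ℂ = ⟪(a : H), h.toFun c⟫_ℂ := hh a c
  induction u using TensorProduct.induction_on with
  | zero => simp only [map_zero, inner_zero_left]
  | add x y hx hy => rw [map_add, map_add, inner_add_left, inner_add_left, hx, hy]
  | tmul a b =>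
    induction v using TensorProduct.induction_on with
    | zero => simp only [map_zero, inner_zero_right]
    | add x y hx hy => rw [map_add, map_add, inner_add_right, inner_add_right, hx, hy]
    | tmul c d =>
      simp only [energySum, LinearMap.add_apply, TensorProduct.map_tmul, TensorProduct.mapIncl,
        inner_add_left, inner_add_right, TensorProduct.inner_tmul, Submodule.subtype_apply, hsymm]

lemma algHamiltonian₂_isFormalAdjoint (hh : h.IsFormalAdjoint h) :
    (algHamiltonian₂ h).IsFormalAdjoint (algHamiltonian₂ h) := by
  rintro ⟨_, u, rfl⟩ ⟨_, v, rfl⟩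
  rw [algHamiltonian₂_domainEmbed, algHamiltonian₂_domainEmbed]
  calc ⟪(energySum h u : Completion (H ⊗[ℂ] H)), domainEmbed h v⟫_ℂ
      = ⟪energySum h u, TensorProduct.mapIncl h.domain h.domain v⟫_ℂ := Completion.inner_coe _ _
    _ = ⟪TensorProduct.mapIncl h.domain h.domain u, energySum h v⟫_ℂ :=
        inner_energySum_left hh u v
    _ = ⟪domainEmbed h u, (energySum h v : Completion (H ⊗[ℂ] H))⟫_ℂ :=
        (Completion.inner_coe (TensorProduct.mapIncl h.domain h.domain u) (energySum h v)).symm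

lemma hamiltonian₂_isFormalAdjoint (hh : h.IsFormalAdjoint h) :
    (hamiltonian₂ h).IsFormalAdjoint (hamiltonian₂ h) :=
  isFormalAdjoint_closure_left
    (isFormalAdjoint_closure_left (algHamiltonian₂_isFormalAdjoint hh)).symm

lemma tprod_mem_eigenspace {e e' : ℝ} {x y : H} (hx : x ∈ eigenspace h e)
    (hy : y ∈ eigenspace h e') : tprod x y ∈ eigenspace (hamiltonian₂ h) (e + e') := by
  obtain ⟨hxh, hxe⟩ := hx
  obtain ⟨hyh, hye⟩ := hy
  obtain ⟨hmem, hval⟩ := algHamiltonian₂_tprod h ⟨x, hxh⟩ ⟨y, hyh⟩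
  obtain ⟨hdom, hext⟩ := (algHamiltonian₂ h).le_closure
  refine ⟨hdom hmem, (hext (x := ⟨tprod x y, hmem⟩) rfl).symm.trans (hval.trans ?_)⟩
  rw [hxe, hye, tprod_smul_left, tprod_smul_right, ← add_smul, Complex.ofReal_add]

end TwoParticleHamiltonian

section TensorSquare

variable {H : Type u} [NormedAddCommGroup H] [InnerProductSpace ℂ H]

lemma apply_eq_sqrt_smul_of_tprod_self [CompleteSpace H] {A : H →L[ℂ] H} (hA : A.IsPositive)
    {x : H} {μ : ℂ} (hμ : tprod (A x) (A x) = μ • tprod x x) : A x = (√μ.re : ℂ) • x := by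
  rcases eq_or_ne x 0 with rfl | hx
  · rw [map_zero, smul_zero]
  have hx' : ‖x‖ ^ 2 ≠ 0 := pow_ne_zero 2 (norm_ne_zero_iff.mpr hx)
  set a : ℝ := (⟪A x, x⟫_ℂ).re
  have ha : ⟪A x, x⟫_ℂ = a := (hA.isSymmetric.coe_re_inner_apply_self x).symm
  have ha' : ⟪x, A x⟫_ℂ = a := (hA.isSymmetric x x).symm.trans ha
  set r : ℝ := a / ‖x‖ ^ 2
  have hr : 0 ≤ r := div_nonneg (hA.re_inner_nonneg_left x) (sq_nonneg _)
  have hμr : μ = (r ^ 2 : ℝ) := by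
    have hinner := congrArg (fun z => ⟪tprod x x, z⟫_ℂ) hμ
    simp only [inner_smul_right, inner_tprod, ha', inner_self_eq_norm_sq_to_K,
      Complex.coe_algebraMap, ← sq] at hinner
    rw [norm_tprod, ← sq] at hinner
    rw [Complex.ofReal_pow, Complex.ofReal_div, div_pow, hinner, Complex.ofReal_pow,
      mul_div_cancel_right₀ _ (pow_ne_zero 2 (mod_cast hx'))]
  have hnorm : ‖A x‖ ^ 2 = r ^ 2 * ‖x‖ ^ 2 := by
    have h := congrArg norm hμ
    rw [norm_smul, norm_tprod, norm_tprod, hμr, Complex.norm_of_nonneg (sq_nonneg r)] at h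
    rw [sq, h, sq ‖x‖]
  -- The norms of `A x` and `r x` agree, and so does `⟪A x, r x⟫`: equality in Cauchy–Schwarz.
  have hzero : ‖A x - (r : ℂ) • x‖ ^ 2 = 0 := by
    have hre : RCLike.re ((r : ℂ) * a) = r * a := by
      rw [← Complex.ofReal_mul]
      exact Complex.ofReal_re _
    have har : a = r * ‖x‖ ^ 2 := (div_mul_cancel₀ a hx').symm
    rw [norm_sub_sq (𝕜 := ℂ), hnorm, norm_smul, inner_smul_right, ha, hre,
      Complex.norm_of_nonneg hr, har]
    ring
  rw [hμr, Complex.ofReal_re, Real.sqrt_sq hr]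
  exact sub_eq_zero.mp (norm_eq_zero.mp (pow_eq_zero_iff two_ne_zero |>.mp hzero))

lemma logAdditive_iff {h : H →ₗ.[ℂ] H} {lam : Spec h → ℝ≥0} :
    LogAdditive lam ↔ ∀ e₁ e₂ e₃ e₄ : Spec h, (e₁ : ℝ) + e₂ = e₃ + e₄ →
      lam e₁ * lam e₂ = lam e₃ * lam e₄ := by
  simp only [LogAdditive, ← ENNReal.log_mul_add, ENNReal.log_injective.eq_iff, ← ENNReal.coe_mul,
    ENNReal.coe_inj]

variable {h : H →ₗ.[ℂ] H} {ι : Type*} {b : HilbertBasis ι ℂ H} {ε : ι → Spec h}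

lemma exists_logAdditive_of_opTensor_self [CompleteSpace H]
    (hb : ∀ i, b i ∈ eigenspace h (ε i)) (hε : ε.Surjective) {A : H →L[ℂ] H}
    (hA : A.IsPositive) {f : Spec (hamiltonian₂ h) → ℂ}
    (hf : IsFunctionOf (hamiltonian₂ h) f (opTensor A A)) :
    ∃ lam : Spec h → ℝ≥0, IsFunctionOf h (fun e => ((lam e : ℝ) : ℂ)) A ∧ LogAdditive lam := by
  have hvec (e : Spec h) : ∃ x ∈ eigenspace h e, x ≠ 0 := by
    obtain ⟨i, rfl⟩ := hε e
    exact ⟨b i, hb i, b.orthonormal.ne_zero i⟩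
  have hspec (e₁ e₂ : Spec h) : (e₁ + e₂ : ℝ) ∈ Spec (hamiltonian₂ h) := by
    obtain ⟨x, hx, hx0⟩ := hvec e₁
    obtain ⟨y, hy, hy0⟩ := hvec e₂
    exact mem_spec_of_mem_eigenspace (tprod_mem_eigenspace hx hy) (tprod_ne_zero hx0 hy0)
  have htensor {e₁ e₂ : Spec h} {x y : H} (hx : x ∈ eigenspace h e₁) (hy : y ∈ eigenspace h e₂) :
      tprod (A x) (A y) = f ⟨e₁ + e₂, hspec e₁ e₂⟩ • tprod x y := by
    rw [← opTensor_tprod]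
    exact hf ⟨e₁ + e₂, hspec e₁ e₂⟩ _ (tprod_mem_eigenspace hx hy)
  let lam (e : Spec h) : ℝ≥0 := ⟨√(f ⟨e + e, hspec e e⟩).re, Real.sqrt_nonneg _⟩
  have hlam : IsFunctionOf h (fun e => ((lam e : ℝ) : ℂ)) A := fun e x hx =>
    apply_eq_sqrt_smul_of_tprod_self hA (htensor hx hx)
  have hmul (e₁ e₂ : Spec h) : ((lam e₁ * lam e₂ : ℝ) : ℂ) = f ⟨e₁ + e₂, hspec e₁ e₂⟩ := by
    obtain ⟨x, hx, hx0⟩ := hvec e₁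
    obtain ⟨y, hy, hy0⟩ := hvec e₂
    refine smul_left_injective ℂ (tprod_ne_zero hx0 hy0) ?_
    dsimp only
    rw [← htensor hx hy, hlam e₁ x hx, hlam e₂ y hy, tprod_smul_left, tprod_smul_right, smul_smul,
      Complex.ofReal_mul]
  refine ⟨lam, hlam, logAdditive_iff.mpr fun e₁ e₂ e₃ e₄ he => ?_⟩
  have hprod : ((lam e₁ * lam e₂ : ℝ) : ℂ) = (lam e₃ * lam e₄ : ℝ) := by
    rw [hmul, hmul]
    exact congrArg f (Subtype.ext he)
  exact_mod_cast hprod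

end TensorSquare

section Resolvent

variable {K : Type u} [NormedAddCommGroup K] [InnerProductSpace ℂ K] {T : K →ₗ.[ℂ] K} {z : ℂ}
  {R : K →L[ℂ] K}

lemma IsResolventAt.ker_eq_bot (hR : IsResolventAt T z R) {y : K} (hy : R y = 0) : y = 0 := by
  obtain ⟨hmem, hval⟩ := hR.1 y
  have h0 : (⟨R y, hmem⟩ : T.domain) = 0 := Subtype.ext hy
  rw [← hval, h0, LinearPMap.map_zero, hy, smul_zero, sub_zero]

lemma IsResolventAt.apply_of_eigenvector (hR : IsResolventAt T z R) {μ : ℂ} (hμ : μ ≠ 0) {x : K}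
    (hx : R x = μ • x) : ∃ hmem : x ∈ T.domain, T ⟨x, hmem⟩ = (z + μ⁻¹) • x := by
  have hRx : R (μ⁻¹ • x) = x := by rw [map_smul, hx, inv_smul_smul₀ hμ]
  obtain ⟨hmem, hval⟩ := hR.1 (μ⁻¹ • x)
  simp only [hRx] at hmem hval
  exact ⟨hmem, by rw [sub_eq_iff_eq_add.mp hval, add_smul, add_comm]⟩

lemma IsResolventAt.comp_inv (hR : IsResolventAt T z R) {w : ℂ} {V : (K →L[ℂ] K)ˣ}
    (hV : (V : K →L[ℂ] K) = 1 - (w - z) • R) :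
    IsResolventAt T w (R ∘L (↑V⁻¹ : K →L[ℂ] K)) := by
  have hVapply (y : K) : y - (w - z) • R y = (V : K →L[ℂ] K) y := by rw [hV]; rfl
  constructor
  · intro y
    obtain ⟨hmem, hval⟩ := hR.1 ((↑V⁻¹ : K →L[ℂ] K) y)
    have hVy : (V : K →L[ℂ] K) ((↑V⁻¹ : K →L[ℂ] K) y) = y := DFunLike.congr_fun V.mul_inv y
    rw [← hVapply] at hVy
    refine ⟨hmem, Eq.trans ?_ hVy⟩
    change T ⟨R ((↑V⁻¹ : K →L[ℂ] K) y), hmem⟩ - w • R ((↑V⁻¹ : K →L[ℂ] K) y) = _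
    rw [sub_eq_iff_eq_add.mp hval]
    module
  · intro x
    have hx : T x - w • (x : K) = (V : K →L[ℂ] K) (T x - z • (x : K)) := by
      rw [← hVapply, hR.2]
      module
    have hVx : (↑V⁻¹ : K →L[ℂ] K) ((V : K →L[ℂ] K) (T x - z • (x : K))) = T x - z • (x : K) :=
      DFunLike.congr_fun V.inv_mul _
    rw [hx, ContinuousLinearMap.comp_apply, hVx, hR.2]

lemma IsResolventAt.exists_of_forall_ne_smul [CompleteSpace K] (hR : IsResolventAt T z R)
    (hc : IsCompactOperator R) {w : ℂ} (hw : ∀ x : T.domain, T x = w • (x : K) → (x : K) = 0) :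
    ∃ R' : K →L[ℂ] K, IsResolventAt T w R' ∧ IsCompactOperator R' := by
  rcases eq_or_ne w z with rfl | hne
  · exact ⟨R, hR, hc⟩
  have hwz : w - z ≠ 0 := sub_ne_zero.mpr hne
  rcases hc.hasEigenvalue_or_mem_resolventSet (inv_ne_zero hwz) with hev | hres
  · obtain ⟨x, hx⟩ := hev.exists_hasEigenvector
    obtain ⟨hmem, hval⟩ := hR.apply_of_eigenvector (inv_ne_zero hwz) hx.apply_eq_smul
    rw [inv_inv, add_sub_cancel] at hval
    exact absurd (hw ⟨x, hmem⟩ hval) hx.2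
  · obtain ⟨V, hV⟩ := (spectrum.mem_resolventSet_iff.mp hres).smul (Units.mk0 _ hwz)
    refine ⟨_, hR.comp_inv (V := V) ?_, hc.comp_clm _⟩
    rw [hV, smul_sub, Algebra.algebraMap_eq_smul_one, Units.smul_mk0, Units.smul_mk0,
      smul_inv_smul₀ hwz]

lemma exists_mem_eigenspace_of_mem_spec [CompleteSpace K] (hT : HasCompactResolvent T) {e : ℝ}
    (he : e ∈ Spec T) : ∃ x ∈ eigenspace T e, x ≠ 0 := by
  obtain ⟨z, R, hR, hc⟩ := hT
  by_contra! hcon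
  obtain ⟨R', hR', -⟩ := hR.exists_of_forall_ne_smul hc fun x hx => hcon x ⟨x.2, hx⟩
  exact he ⟨R', hR'⟩

lemma IsResolventAt.isSymmetric (hs : T.IsFormalAdjoint T) {w : ℝ} (hR : IsResolventAt T w R) :
    (R : K →ₗ[ℂ] K).IsSymmetric := by
  intro x y
  obtain ⟨hx, hx'⟩ := hR.1 x
  obtain ⟨hy, hy'⟩ := hR.1 y
  calc ⟪R x, y⟫_ℂ = ⟪R x, T ⟨R y, hy⟩ - (w : ℂ) • R y⟫_ℂ := by rw [hy']
    _ = ⟪T ⟨R x, hx⟩ - (w : ℂ) • R x, R y⟫_ℂ := by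
      rw [inner_sub_left, inner_sub_right, hs ⟨R x, hx⟩ ⟨R y, hy⟩, inner_smul_left,
        inner_smul_right, Complex.conj_ofReal]
    _ = ⟪x, R y⟫_ℂ := by rw [hx']

lemma countable_setOf_eigenspace_ne_bot [TopologicalSpace.SeparableSpace K]
    (hs : T.IsFormalAdjoint T) : {e : ℝ | eigenspace T e ≠ ⊥}.Countable := by
  have hunit (e : {e : ℝ | eigenspace T e ≠ ⊥}) : ∃ x ∈ eigenspace T e, ‖x‖ = 1 := by
    obtain ⟨x, hx, hx0⟩ := (Submodule.ne_bot_iff _).mp e.2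
    exact ⟨_, Submodule.smul_mem _ _ hx, norm_smul_inv_norm (𝕜 := ℂ) hx0⟩
  choose v hv hv1 using hunit
  have hv : Orthonormal ℂ v :=
    ⟨hv1, fun e e' hne =>
      inner_eq_zero_of_mem_eigenspace hs (Subtype.coe_ne_coe.mpr hne) (hv e) (hv e')⟩
  exact Set.countable_coe_iff.mp (countable_of_orthonormal hv)

lemma exists_isCompactOperator_isResolventAt_real [CompleteSpace K]
    [TopologicalSpace.SeparableSpace K] (hs : T.IsFormalAdjoint T) (hT : HasCompactResolvent T) :
    ∃ (w : ℝ) (R : K →L[ℂ] K), IsResolventAt T w R ∧ IsCompactOperator R := by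
  obtain ⟨z, R, hR, hc⟩ := hT
  obtain ⟨w, hw⟩ : ∃ w : ℝ, w ∉ {e : ℝ | eigenspace T e ≠ ⊥} := by
    refine (Set.ne_univ_iff_exists_notMem _).mp fun huniv => Set.not_countable_univ (α := ℝ) ?_
    rw [← huniv]
    exact countable_setOf_eigenspace_ne_bot hs
  have hbot : eigenspace T w = ⊥ := not_not.mp hw
  exact ⟨w, hR.exists_of_forall_ne_smul hc fun x hx =>
    (Submodule.mem_bot ℂ).mp (hbot ▸ (⟨x.2, hx⟩ : (x : K) ∈ eigenspace T w))⟩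

lemma exists_eigenbasis_of_hasCompactResolvent [CompleteSpace K]
    [TopologicalSpace.SeparableSpace K] (hs : T.IsFormalAdjoint T) (hT : HasCompactResolvent T) :
    ∃ (ι : Type u) (b : HilbertBasis ι ℂ K) (ε : ι → Spec T),
      (∀ i, b i ∈ eigenspace T (ε i)) ∧ ε.Surjective := by
  obtain ⟨w, R, hR, hc⟩ := exists_isCompactOperator_isResolventAt_real hs hT
  obtain ⟨s, b, p, hp⟩ := exists_isDiagonal hc (hR.isSymmetric hs)
  have hmem (i : s) : b i ∈ eigenspace T (w + (p i)⁻¹) := by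
    have hp0 : (p i : ℂ) ≠ 0 := fun h0 =>
      b.orthonormal.ne_zero i (hR.ker_eq_bot (by rw [hp, h0, zero_smul]))
    obtain ⟨hdom, hval⟩ := hR.apply_of_eigenvector hp0 (hp i)
    exact ⟨hdom, by rw [hval, Complex.ofReal_add, Complex.ofReal_inv]⟩
  refine ⟨s, b, fun i => ⟨_, mem_spec_of_mem_eigenspace (hmem i) (b.orthonormal.ne_zero i)⟩, hmem,
    fun e => ?_⟩
  obtain ⟨x, hx, hx0⟩ := exists_mem_eigenspace_of_mem_spec hT e.2
  by_contra! hne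
  refine hx0 (ext_inner_hilbertBasis b fun i => ?_)
  rw [inner_zero_right]
  exact inner_eq_zero_of_mem_eigenspace hs (Subtype.coe_ne_coe.mpr (hne i)) (hmem i) hx

end Resolvent

section PartialTrace

variable {H : Type u} [NormedAddCommGroup H] [InnerProductSpace ℂ H] [CompleteSpace H]

lemma inner_partialTrace_term (φ ψ x : H) (T : TwoParticle H →L[ℂ] TwoParticle H) :
    ⟪φ, ((tensorRight x).adjoint ∘L T ∘L tensorRight x) ψ⟫_ℂ = ⟪tprod φ x, T (tprod ψ x)⟫_ℂ := by
  rw [ContinuousLinearMap.comp_apply, ContinuousLinearMap.adjoint_inner_right]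
  rfl

lemma inner_adjoint_tensorLeft_comp (φ x : H) (T : TwoParticle H →L[ℂ] TwoParticle H) :
    ⟪x, ((tensorLeft φ).adjoint ∘L T ∘L tensorLeft φ) x⟫_ℂ = ⟪tprod φ x, T (tprod φ x)⟫_ℂ := by
  rw [ContinuousLinearMap.comp_apply, ContinuousLinearMap.adjoint_inner_right]
  rfl

-- The assumption `partialTrace₂ T ≠ 0` excludes the junk value of a divergent series.
lemma ofReal_re_inner_partialTrace₂ {T : TwoParticle H →L[ℂ] TwoParticle H} (hT : T.IsPositive)
    (h0 : partialTrace₂ T ≠ 0) {ι : Type*} (b : HilbertBasis ι ℂ H) (φ : H) :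
    ENNReal.ofReal (⟪φ, partialTrace₂ T φ⟫_ℂ).re =
      ∑' j, ENNReal.ofReal (⟪tprod φ (b j), T (tprod φ (b j))⟫_ℂ).re := by
  have hsummable := by_contra fun hns => h0 (tsum_eq_zero_of_not_summable hns)
  have hsum : HasSum
      (fun k : basisSet H => (⟪tprod φ (hbasis H k), T (tprod φ (hbasis H k))⟫_ℂ).re)
      (⟪φ, partialTrace₂ T φ⟫_ℂ).re := by
    have h := (hsummable.hasSum.mapL (ContinuousLinearMap.apply ℂ H φ)).mapL (innerSL ℂ φ)
    exact (Complex.hasSum_re h).congr_fun fun k =>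
      congrArg Complex.re (inner_partialTrace_term φ φ _ T).symm
  have htrace := posTrace_eq_tsum b (hT.adjoint_conj (tensorLeft φ))
  rw [posTrace] at htrace
  simp only [inner_adjoint_tensorLeft_comp] at htrace
  rw [← htrace, ← hsum.tsum_eq]
  exact ENNReal.ofReal_tsum_of_nonneg (fun k => hT.re_inner_nonneg_right _) hsum.summable

lemma IsDensityMatrix.hasSum_re_inner {ρ : H →L[ℂ] H} (hρ : IsDensityMatrix ρ) :
    HasSum (fun k : basisSet H => (⟪hbasis H k, ρ (hbasis H k)⟫_ℂ).re) 1 := by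
  obtain ⟨hpos, htr⟩ := hρ
  have hsum := ENNReal.hasSum_toReal (htr.trans_ne ENNReal.one_ne_top)
  rw [← ENNReal.tsum_toReal_eq fun k => ENNReal.ofReal_ne_top] at hsum
  have hone : (∑' k : basisSet H, ENNReal.ofReal (⟪hbasis H k, ρ (hbasis H k)⟫_ℂ).re).toReal = 1 :=
    (congrArg ENNReal.toReal htr).trans ENNReal.toReal_one
  rw [hone] at hsum
  exact hsum.congr_fun fun k => (ENNReal.toReal_ofReal (hpos.re_inner_nonneg_right _)).symm

lemma partialTrace₂_opTensor {ρ : H →L[ℂ] H} (hρ : IsDensityMatrix ρ) (A : H →L[ℂ] H) :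
    partialTrace₂ (opTensor A ρ) = A := by
  have hterm (x : H) : (tensorRight x).adjoint ∘L opTensor A ρ ∘L tensorRight x =
      ((⟪x, ρ x⟫_ℂ).re : ℂ) • A := by
    refine ContinuousLinearMap.ext fun ψ => ext_inner_left ℂ fun φ => ?_
    have hreal : ((⟪x, ρ x⟫_ℂ).re : ℂ) = ⟪x, ρ x⟫_ℂ := by
      rw [← hρ.1.inner_left_eq_inner_right]
      exact hρ.1.isSymmetric.coe_re_inner_apply_self x
    rw [inner_partialTrace_term, opTensor_tprod, inner_tprod, smul_apply, inner_smul_right, hreal,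
      mul_comm]
  simp only [partialTrace₂, hterm]
  simpa only [Complex.ofRealCLM_apply, Complex.ofReal_one, one_smul] using
    ((hρ.hasSum_re_inner.mapL Complex.ofRealCLM).smul_const A).tsum_eq

end PartialTrace

section Collisions

variable {H : Type u} [NormedAddCommGroup H] [InnerProductSpace ℂ H] {h : H →ₗ.[ℂ] H}
  {C : Type v} [MetricSpace C] [CompactSpace C] [MeasurableSpace C] [BorelSpace C]

namespace CollisionSpec

variable (S : CollisionSpec h C)

lemma star_op_inner (σ : C) (x y : TwoParticle H) : ⟪star (S.op σ) x, y⟫_ℂ = ⟪x, S.op σ y⟫_ℂ :=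
  ContinuousLinearMap.adjoint_inner_left _ _ _

lemma integrable_inner_conj (A : TwoParticle H →L[ℂ] TwoParticle H) (x y : TwoParticle H) :
    Integrable (fun σ => ⟪star (S.op σ) x, A (star (S.op σ) y)⟫_ℂ) S.ν := by
  simp only [star_op_inner]
  exact (S.integrable_conj A y).const_inner x

lemma inner_collisionOp (A : TwoParticle H →L[ℂ] TwoParticle H) (x y : TwoParticle H) :
    ⟪x, S.collisionOp A y⟫_ℂ = ∫ σ, ⟪star (S.op σ) x, A (star (S.op σ) y)⟫_ℂ ∂S.ν := by
  simp only [star_op_inner]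
  rw [collisionOp_apply, ← integral_inner (S.integrable_conj A y)]

open scoped ComplexOrder in
lemma isPositive_collisionOp {A : TwoParticle H →L[ℂ] TwoParticle H} (hA : A.IsPositive) :
    (S.collisionOp A).IsPositive := by
  refine (ContinuousLinearMap.isPositive_iff_complex _).mpr fun x => ?_
  have hnonneg : 0 ≤ ⟪S.collisionOp A x, x⟫_ℂ := by
    rw [← inner_conj_symm, inner_collisionOp, ← integral_conj]
    refine integral_nonneg fun σ => ?_
    simp only [inner_conj_symm]
    exact hA.inner_nonneg_left _
  obtain ⟨hre, him⟩ := Complex.nonneg_iff.mp hnonneg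
  exact ⟨Complex.ext rfl him, hre⟩

lemma ofReal_re_inner_collisionOp {A : TwoParticle H →L[ℂ] TwoParticle H} (hA : A.IsPositive)
    (x : TwoParticle H) :
    ENNReal.ofReal (⟪x, S.collisionOp A x⟫_ℂ).re =
      ∫⁻ σ, ENNReal.ofReal (⟪star (S.op σ) x, A (star (S.op σ) x)⟫_ℂ).re ∂S.ν := by
  have hint := S.integrable_inner_conj A x x
  rw [inner_collisionOp]
  exact (congrArg ENNReal.ofReal (integral_re hint).symm).trans <|
    ofReal_integral_eq_lintegral_ofReal hint.re (.of_forall fun σ => hA.re_inner_nonneg_right _)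

/-- The transition probability `|⟨x, U(σ) y⟩|²` from `y` to `x`, averaged over the collision
parameter `σ`. -/
def transition (x y : TwoParticle H) : ℝ≥0∞ := ∫⁻ σ, ‖⟪x, S.op σ y⟫_ℂ‖ₑ ^ 2 ∂S.ν

lemma continuous_inner_op (x y : TwoParticle H) : Continuous fun σ => ⟪x, S.op σ y⟫_ℂ :=
  continuous_const.inner (S.continuous_U y)

lemma measurable_enorm_inner_op_sq (x y : TwoParticle H) :
    Measurable fun σ => ‖⟪x, S.op σ y⟫_ℂ‖ₑ ^ 2 :=
  (S.continuous_inner_op x y).enorm.measurable.pow_const 2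

lemma isDoublyStochastic_transition {κ : Type*} [Countable κ]
    (c : HilbertBasis κ ℂ (TwoParticle H)) :
    IsDoublyStochastic fun m k => S.transition (c m) (c k) where
  tsum_row m := by
    have := S.isProbabilityMeasure
    have hrow (σ : C) : ∑' k, ‖⟪c m, S.op σ (c k)⟫_ℂ‖ₑ ^ 2 = 1 := by
      simp only [← S.star_op_inner, enorm_inner_symm (star (S.op σ) (c m))]
      rw [tsum_enorm_inner_sq, ← ofReal_norm, S.norm_star_op_apply, c.orthonormal.1,
        ENNReal.ofReal_one, one_pow]
    simp only [transition]
    rw [← lintegral_tsum fun k => (S.measurable_enorm_inner_op_sq _ _).aemeasurable]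
    simp only [hrow, lintegral_one, measure_univ]
  tsum_col k := by
    have := S.isProbabilityMeasure
    have hcol (σ : C) : ∑' m, ‖⟪c m, S.op σ (c k)⟫_ℂ‖ₑ ^ 2 = 1 := by
      rw [tsum_enorm_inner_sq, ← ofReal_norm, S.norm_op_apply, c.orthonormal.1,
        ENNReal.ofReal_one, one_pow]
    simp only [transition]
    rw [← lintegral_tsum fun m => (S.measurable_enorm_inner_op_sq _ _).aemeasurable]
    simp only [hcol, lintegral_one, measure_univ]

lemma transition_swap (x y : TwoParticle H) :
    S.transition (swap H x) (swap H y) = S.transition x y := by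
  obtain ⟨τ, hτ, hτν⟩ := S.swap_symmetric
  have hconj (σ : C) : S.op (τ σ) y = swap H (S.op σ (swap H y)) := by
    rw [op, ← hτ σ, adjoint_swap]
    rfl
  rw [transition, transition, ← hτν.lintegral_comp (S.measurable_enorm_inner_op_sq x y)]
  simp only [hconj, ← swap_inner]

lemma inner_op_eq_zero_of_transition_eq_zero {x y : TwoParticle H} (h0 : S.transition x y = 0)
    (σ : C) : ⟪x, S.op σ y⟫_ℂ = 0 := by
  have : S.ν.IsOpenPosMeasure := ⟨fun O hO hne => (S.charges_open O hO hne).ne'⟩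
  rw [transition, lintegral_eq_zero_iff (S.measurable_enorm_inner_op_sq x y)] at h0
  have hae : (fun σ => ⟪x, S.op σ y⟫_ℂ) =ᵐ[S.ν] fun _ => 0 :=
    h0.mono fun σ hσ => enorm_eq_zero.mp (pow_eq_zero_iff two_ne_zero |>.mp hσ)
  exact congrFun (((S.continuous_inner_op x y).ae_eq_iff_eq S.ν continuous_const).mp hae) σ

lemma ofReal_re_inner_collisionOp_of_isDiagonal {κ : Type*} [Countable κ]
    {c : HilbertBasis κ ℂ (TwoParticle H)} {a : κ → ℝ} {A : TwoParticle H →L[ℂ] TwoParticle H}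
    (hA : IsDiagonal c a A) (ha : ∀ k, 0 ≤ a k) (x : TwoParticle H) :
    ENNReal.ofReal (⟪x, S.collisionOp A x⟫_ℂ).re =
      ∑' k, S.transition x (c k) * ENNReal.ofReal (a k) := by
  have hterm (σ : C) : ENNReal.ofReal (⟪star (S.op σ) x, A (star (S.op σ) x)⟫_ℂ).re =
      ∑' k, ‖⟪x, S.op σ (c k)⟫_ℂ‖ₑ ^ 2 * ENNReal.ofReal (a k) := by
    rw [hA.ofReal_re_inner ha]
    refine tsum_congr fun k => ?_
    rw [enorm_inner_symm, star_op_inner, mul_comm]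
  simp only [S.ofReal_re_inner_collisionOp (hA.isPositive ha), hterm]
  rw [lintegral_tsum fun k => ((S.measurable_enorm_inner_op_sq _ _).mul_const _).aemeasurable]
  exact tsum_congr fun k => lintegral_mul_const _ (S.measurable_enorm_inner_op_sq _ _)

lemma collisionOp_of_commute {A : TwoParticle H →L[ℂ] TwoParticle H}
    (hA : ∀ σ, S.op σ ∘L A = A ∘L S.op σ) : S.collisionOp A = A := by
  have := S.isProbabilityMeasure
  have hconj (x : TwoParticle H) (σ : C) : S.op σ (A (star (S.op σ) x)) = A x :=
    (DFunLike.congr_fun (hA σ) (star (S.op σ) x)).trans (congrArg A (S.op_star_op_apply σ x))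
  ext x
  simp only [collisionOp_apply, hconj, integral_const, probReal_univ, one_smul]

end CollisionSpec

end Collisions

section SteadyStates

variable {H : Type u} [NormedAddCommGroup H] [InnerProductSpace ℂ H] {h : H →ₗ.[ℂ] H}
  {C : Type v} [MetricSpace C] [CompactSpace C] [MeasurableSpace C] [BorelSpace C]
  {S : CollisionSpec h C} {ρ : H →L[ℂ] H} {ι : Type*} {b : HilbertBasis ι ℂ H} {p : ι → ℝ}

lemma CollisionSpec.transition_tensorBasis_swap (S : CollisionSpec h C) (m k : ι × ι) :
    S.transition (tensorBasis b b m.swap) (tensorBasis b b k.swap) =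
      S.transition (tensorBasis b b m) (tensorBasis b b k) := by
  rw [← S.transition_swap]
  simp only [tensorBasis_apply, swap_tprod, Prod.fst_swap, Prod.snd_swap]

variable [CompleteSpace H]

lemma IsDensityMatrix.ne_zero (hρ : IsDensityMatrix ρ) : ρ ≠ 0 := by
  rintro rfl
  simpa [posTrace] using hρ.2

lemma IsDiagonal.entropy_eq_crossEntropy (hρ : IsDiagonal b p ρ) (hp : ∀ i, 0 ≤ p i)
    (hp1 : ∀ i, p i ≤ 1) :
    entropy ρ = crossEntropy (fun i => ENNReal.ofReal (p i)) fun i => ENNReal.ofReal (p i) := by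
  rw [hρ.entropy_eq hp hp1, crossEntropy]
  exact tsum_congr fun i => ofReal_negMulLog (hp i)

namespace CollisionSpec

lemma IsSteadyState.left_marginal [Countable ι] (hρ : S.IsSteadyState ρ) (hb : IsDiagonal b p ρ)
    (i : ι) :
    ∑' j, ∑' k : ι × ι, S.transition (tensorBasis b b (i, j)) (tensorBasis b b k) *
      (ENNReal.ofReal (p k.1) * ENNReal.ofReal (p k.2)) = ENNReal.ofReal (p i) := by
  obtain ⟨hdens, hsteady⟩ := hρ
  have hp := hb.nonneg hdens.1
  have hdiag := hb.opTensor hb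
  have hdiag_nonneg (k : ι × ι) : 0 ≤ p k.1 * p k.2 := mul_nonneg (hp _) (hp _)
  have htrace : partialTrace₂ (S.collisionOp (opTensor ρ ρ)) = ρ := hsteady.symm
  have hmarg := ofReal_re_inner_partialTrace₂
    (S.isPositive_collisionOp (hdiag.isPositive hdiag_nonneg))
    (htrace.trans_ne hdens.ne_zero) b (b i)
  rw [htrace, hb.re_inner_self] at hmarg
  rw [hmarg]
  refine tsum_congr fun j => ?_
  rw [← tensorBasis_apply b b (i, j),
    S.ofReal_re_inner_collisionOp_of_isDiagonal hdiag hdiag_nonneg]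
  simp only [ENNReal.ofReal_mul (hp _)]

lemma IsSteadyState.right_marginal [Countable ι] (hρ : S.IsSteadyState ρ) (hb : IsDiagonal b p ρ)
    (j : ι) :
    ∑' i, ∑' k : ι × ι, S.transition (tensorBasis b b (i, j)) (tensorBasis b b k) *
      (ENNReal.ofReal (p k.1) * ENNReal.ofReal (p k.2)) = ENNReal.ofReal (p j) := by
  rw [← hρ.left_marginal hb j]
  refine tsum_congr fun i => ?_
  rw [← (Equiv.prodComm ι ι).tsum_eq]
  refine tsum_congr fun k => ?_
  rw [← S.transition_tensorBasis_swap (j, i) k, mul_comm (ENNReal.ofReal (p k.1))]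
  rfl

lemma IsSteadyState.op_comp_opTensor [TopologicalSpace.SeparableSpace H] (hρ : S.IsSteadyState ρ)
    (hent : entropy ρ ≠ ⊤) (σ : C) : S.op σ ∘L opTensor ρ ρ = opTensor ρ ρ ∘L S.op σ := by
  obtain ⟨ι, b, p, hb, hp, hp1⟩ := hρ.1.exists_isDiagonal
  have : Countable ι := countable_of_orthonormal b.orthonormal
  have hp_le (i : ι) : p i ≤ 1 := ENNReal.ofReal_le_one.mp ((ENNReal.le_tsum i).trans_eq hp1)
  rw [hb.entropy_eq_crossEntropy hp hp_le] at hent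
  refine (hb.opTensor hb).comp_eq_comp fun m k hmk => ?_
  have htrans : S.transition (tensorBasis b b m) (tensorBasis b b k) ≠ 0 := fun h0 =>
    hmk (S.inner_op_eq_zero_of_transition_eq_zero h0 σ)
  have hmul := (S.isDoublyStochastic_transition (tensorBasis b b)).mul_eq_mul_of_marginals hp1 hent
    (hρ.left_marginal hb) (hρ.right_marginal hb) htrans
  rwa [← ENNReal.ofReal_mul (hp _), ← ENNReal.ofReal_mul (hp _),
    ENNReal.ofReal_eq_ofReal_iff (mul_nonneg (hp _) (hp _)) (mul_nonneg (hp _) (hp _))] at hmul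

lemma IsErgodic.exists_isFunctionOf_opTensor [TopologicalSpace.SeparableSpace H] (hS : S.IsErgodic)
    (hh : h.IsFormalAdjoint h) (hρ : S.IsSteadyState ρ) (hent : entropy ρ ≠ ⊤) :
    ∃ f, IsFunctionOf (hamiltonian₂ h) f (opTensor ρ ρ) := by
  have hmem : opTensor ρ ρ ∈ energyAlgebra (hamiltonian₂ h) :=
    hS ▸ fun σ => hρ.op_comp_opTensor hent σ
  obtain ⟨f, hf⟩ := hmem
  exact ⟨f, isFunctionOf_of_hasSum_apply (hamiltonian₂_isFormalAdjoint hh) hf⟩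

lemma isSteadyState_of_logAdditive (S : CollisionSpec h C) (hh : h.IsFormalAdjoint h)
    {ε : ι → Spec h} (hb : ∀ i, b i ∈ eigenspace h (ε i)) (hρ : IsDensityMatrix ρ)
    {lam : Spec h → ℝ≥0} (hlam : IsFunctionOf h (fun e => ((lam e : ℝ) : ℂ)) ρ)
    (hlog : LogAdditive lam) : S.IsSteadyState ρ := by
  have hdiag := hlam.isDiagonal hb
  have henergy (k : ι × ι) :
      tensorBasis b b k ∈ eigenspace (hamiltonian₂ h) ((ε k.1 : ℝ) + ε k.2) :=
    tensorBasis_apply b b k ▸ tprod_mem_eigenspace (hb k.1) (hb k.2)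
  have hcomm (σ : C) : S.op σ ∘L opTensor ρ ρ = opTensor ρ ρ ∘L S.op σ := by
    refine (hdiag.opTensor hdiag).comp_eq_comp fun m k hmk => ?_
    have hconserved : (ε m.1 : ℝ) + ε m.2 = ε k.1 + ε k.2 := by
      by_contra hne
      exact hmk (inner_eq_zero_of_mem_eigenspace (hamiltonian₂_isFormalAdjoint hh) hne (henergy m)
        ((S.commutes σ).apply_mem_eigenspace (henergy k)))
    exact_mod_cast logAdditive_iff.mp hlog _ _ _ _ hconserved
  refine ⟨hρ, ?_⟩
  rw [wild, S.collisionOp_of_commute hcomm, partialTrace₂_opTensor hρ]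

end CollisionSpec

end SteadyStates

end QKac

end

theorem theorem3p8_general {H : Type*} [NormedAddCommGroup H] [InnerProductSpace ℂ H]
    [CompleteSpace H] [TopologicalSpace.SeparableSpace H]
    (h : H →ₗ.[ℂ] H) (hsa : IsSelfAdjoint h) (hcompact : QKac.HasCompactResolvent h)
    {C : Type*} [MetricSpace C] [CompactSpace C] [MeasurableSpace C] [BorelSpace C]
    (S : QKac.CollisionSpec h C) (hS : S.IsErgodic) :
    (∀ ρ : H →L[ℂ] H, S.IsSteadyState ρ → QKac.entropy ρ < ⊤ →
      ∃ lam : QKac.Spec h → NNReal,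
        HasSum (fun e : QKac.Spec h => ((lam e : ℝ) : ℂ) • QKac.specProj h e) ρ ∧
        ∑' e : QKac.Spec h, QKac.posTrace (QKac.specProj h e) * (lam e : ENNReal) = 1 ∧
        QKac.LogAdditive lam) ∧
    (∀ ρ : H →L[ℂ] H, QKac.IsDensityMatrix ρ →
      ∀ lam : QKac.Spec h → NNReal,
        HasSum (fun e : QKac.Spec h => ((lam e : ℝ) : ℂ) • QKac.specProj h e) ρ →
        QKac.LogAdditive lam → S.IsSteadyState ρ) := by
  have hs := QKac.isFormalAdjoint_of_isSelfAdjoint hsa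
  obtain ⟨ι, b, ε, hb, hε⟩ := QKac.exists_eigenbasis_of_hasCompactResolvent hs hcompact
  refine ⟨fun ρ hρ hent => ?_, fun ρ hρ lam hsum hlog =>
    S.isSteadyState_of_logAdditive hs hb hρ (QKac.isFunctionOf_of_hasSum hs hsum) hlog⟩
  obtain ⟨f, hf⟩ := hS.exists_isFunctionOf_opTensor hs hρ hent.ne
  obtain ⟨lam, hlam, hlog⟩ := QKac.exists_logAdditive_of_opTensor_self hb hε hρ.1.1 hf
  obtain ⟨hsum, htr⟩ := hlam.spectral_resolution hs hb hε hρ.1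
  exact ⟨lam, hsum, htr, hlog⟩

theorem theorem3p8 {H : Type*} [NormedAddCommGroup H] [InnerProductSpace ℂ H] [CompleteSpace H]
    [TopologicalSpace.SeparableSpace H]
    (h : H →ₗ.[ℂ] H) (hsa : IsSelfAdjoint h) (hbelow : QKac.IsBoundedBelow h)
    (hcompact : QKac.HasCompactResolvent h)
    {C : Type*} [MetricSpace C] [CompactSpace C] [MeasurableSpace C] [BorelSpace C]
    (S : QKac.CollisionSpec h C) (hS : S.IsErgodic) :
    (∀ ρ : H →L[ℂ] H, S.IsSteadyState ρ → QKac.entropy ρ < ⊤ →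
      ∃ lam : QKac.Spec h → NNReal,
        HasSum (fun e : QKac.Spec h => ((lam e : ℝ) : ℂ) • QKac.specProj h e) ρ ∧
        ∑' e : QKac.Spec h, QKac.posTrace (QKac.specProj h e) * (lam e : ENNReal) = 1 ∧
        QKac.LogAdditive lam) ∧
    (∀ ρ : H →L[ℂ] H, QKac.IsDensityMatrix ρ →
      ∀ lam : QKac.Spec h → NNReal,
        HasSum (fun e : QKac.Spec h => ((lam e : ℝ) : ℂ) • QKac.specProj h e) ρ →
        QKac.LogAdditive lam → S.IsSteadyState ρ) := by
  exact theorem3p8_general h hsa hcompact S hS
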